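/- Let $n\ge 0$ and consider a car $\mathcal B_0$ pulling $n$ trailers $\mathcal B_1,\dots,\mathcal B_n$ on the plane. Let $(x_i,y_i)$ be the midpoint of the wheels' axis of $\mathcal B_i$ and $\theta_i$ its orientation, and put $x=x_0$, $y=y_0$, $\theta=\theta_0$. The bodies are linked by $x_i+\ell\cos\theta_i=x_{i-1}$, $y_i+\ell\sin\theta_i=y_{i-1}$ ($1\le i\le n$), so that the configuration space is $\mathcal Q=SE(2)\times\mathbb T^n$ with coordinates $(x,y,\theta_0,\dots,\theta_n)$, and the motion is subject to the nonholonomic constraints $\dot x_i\sin\theta_i-\dot y_i\cos\theta_i=0$ ($0\le i\le n$), which define a distribution $\mathcal D\subset T\mathcal Q$. The Lagrangian is the kinetic energy $$\mathcal L=\tfrac12\Big(J_0\dot\theta_0^2+M(\dot x_C^2+\dot y_C^2)+J\sum_{i=1}^n\dot\theta_i^2+m\sum_{i=1}^n(\dot x_i^2+\dot y_i^2)\Big),\qquad x_C=x+a\cos\theta,\quad y_C=y+a\sin\theta,$$ with $\ell,M,J_0>0$, $m,J\ge 0$ and $a\in\mathbb R$. A motion is a $C^2$ curve $q(t)$ in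 $\mathcal Q$, defined on an open interval, with $\dot q\in\mathcal D$ that satisfies the Lagrange–d'Alembert principle $\big(\frac{d}{dt}\frac{\partial\mathcal L}{\partial\dot q}-\frac{\partial\mathcal L}{\partial q}\big)\cdot\delta q=0$ for all $\delta q\in\mathcal D_q$. The group $SE(2)$ acts on $\mathcal Q$ by rotation by an angle $\varphi$ and translation of $(x,y)$ together with $\theta_i\mapsto\theta_i+\varphi$. Put $\alpha_k=\theta_{k-1}-\theta_k$ ($1\le k\le n$), $u=\dot x\cos\theta+\dot y\sin\theta$, $\omega=\dot\theta$. Set $\alpha_0=0$ (and $\alpha_1=0$ in the formula for $Q$ if $n=0$), let empty sums be $0$ and empty products $1$, and let $$A_k=\frac1\ell\Big(\prod_{j=1}^{k-2}\cos\alpha_j\Big)\big(\sin\alpha_{k-1}-\cos\alpha_{k-1}\sin\alpha_k\big),\qquad 1\le k\le n,$$ $$Q(\alpha)=\cos\alpha_1\sin\alpha_1\Big(m\ell^2\sum_{j=1}^n\prod_{k=2}^j\cos^2\alpha_k-J\prod_{k=2}^n\cos^2\alpha_k\Big),$$ $$R(\alpha)=M+m\sum_{j=1}^n\prod_{k=1}^j\cos^2\alpha_k+\frac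 J{\ell^2}\Big(1-\prod_{k=1}^n\cos^2\alpha_k\Big).$$ **Theorem.** (i) $\mathcal L$ and $\mathcal D$ are well defined on $\mathcal Q$ (they are $2\pi$-periodic in the angles $\theta_i$) and invariant under the tangent lift of the $SE(2)$ action. The vector fields $Z_1=\cos\theta\,\partial_x+\sin\theta\,\partial_y+\sum_{k=1}^nA_k\,\partial_{\alpha_k}$ and $Z_2=\partial_\theta+\partial_{\alpha_1}$, written in the coordinates $(x,y,\theta,\alpha_1,\dots,\alpha_n)$ (with $Z_2=\partial_\theta$ if $n=0$), form a basis of $\mathcal D$, every $v\in\mathcal D$ is $v=uZ_1+\omega Z_2$, and $(\alpha,u,\omega)$ are global coordinates on the reduced space, i.e. they identify $\mathcal D/SE(2)$ with $\mathbb T^n\times\mathbb R^2$. (ii) On $\mathcal D$ one has $\mathcal L=\frac12\big(R(\alpha)u^2+(J_0+Ma^2)\omega^2\big)$, and the orthogonal projection of $[Z_1,Z_2]$ onto $\mathcal D$ with respect to the kinetic energy metric is $\frac{Q(\alpha)}{\ell^2R(\alpha)}Z_1-\frac{Ma}{J_0+Ma^2}Z_2$. Moreover $R(\alpha)>0$ for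 all $\alpha$. (iii) The reduced equations of motion are the $n+2$ equations $$\dot u=-\frac1{2R(\alpha)}\Big(\sum_{k=1}^nA_k\frac{\partial R}{\partial\alpha_k}\Big)u^2+\frac{Q(\alpha)}{\ell^2R(\alpha)}u\omega+\frac{Ma}{R(\alpha)}\omega^2,\qquad \dot\omega=-\frac{Ma\,u\omega}{J_0+Ma^2},$$ $$\dot\alpha_1=\omega-\frac{u\sin\alpha_1}\ell,\qquad \dot\alpha_k=\frac u\ell\Big(\prod_{j=1}^{k-2}\cos\alpha_j\Big)\big(\sin\alpha_{k-1}-\cos\alpha_{k-1}\sin\alpha_k\big),\quad k=2,\dots,n.$$ That is: along every motion the functions $u,\omega,\alpha_1,\dots,\alpha_n$ satisfy this system; and conversely, for every solution of this system on an open interval and every configuration with the shape angles $\alpha(t_0)$ at a time $t_0$ of that interval, there is exactly one motion on that interval that starts at that configuration at time $t_0$ and has this solution as its reduced curve. -/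

import Mathlib

noncomputable section

namespace NTrailer

/-- The physical parameters of the vehicle: `ℓ` is the length of the links, `M` and `J0` are the
mass of the leading car and its moment of inertia about its centre of mass, `a` is the displacement
of that centre of mass from the wheels' axis, and `m`, `J` are the mass and the moment of inertia of
each of the trailers. -/
structure Params where
  ℓ : ℝ
  M : ℝ
  m : ℝ
  J : ℝ
  J0 : ℝ
  a : ℝ

/-- Coordinates `(x, y, (θ_0, θ_1, …, θ_n))` on the configuration space `SE(2) × 𝕋ⁿ`; the angles are
real numbers, two coordinate vectors being the same configuration when `SameConfig` holds. The same
vector space holds the velocities `(ẋ, ẏ, (θ̇_0, …, θ̇_n))`. -/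
abbrev Coord (n : ℕ) : Type := ℝ × ℝ × (Fin (n + 1) → ℝ)

variable {n : ℕ}

/-- The angle `θ_i` of a configuration (or the angular velocity of body `i` of a velocity). -/
def ang (q : Coord n) (i : Fin (n + 1)) : ℝ := q.2.2 i

/-- Two coordinate vectors describe the same configuration: the angles agree modulo `2π`. -/
def SameConfig (q q' : Coord n) : Prop :=
  q.1 = q'.1 ∧ q.2.1 = q'.2.1 ∧ ∀ i, (ang q i : Real.Angle) = (ang q' i : Real.Angle)

/-! ### Kinematics -/

/-- The coordinate `x_i` of the midpoint of the wheels' axis of body `i`, determined by the holonomic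
constraints `x_0 = x`, `x_i + ℓ cos θ_i - x_{i-1} = 0`. -/
def bodyX (p : Params) (i : Fin (n + 1)) (q : Coord n) : ℝ :=
  Fin.induction (motive := fun _ => ℝ) q.1 (fun j xj => xj - p.ℓ * Real.cos (ang q j.succ)) i

/-- The coordinate `y_i` of the midpoint of the wheels' axis of body `i`, determined by the holonomic
constraints `y_0 = y`, `y_i + ℓ sin θ_i - y_{i-1} = 0`. -/
def bodyY (p : Params) (i : Fin (n + 1)) (q : Coord n) : ℝ :=
  Fin.induction (motive := fun _ => ℝ) q.2.1 (fun j yj => yj - p.ℓ * Real.sin (ang q j.succ)) i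

/-- The centre of mass of the leading car. -/
def comX (p : Params) (q : Coord n) : ℝ := q.1 + p.a * Real.cos (ang q 0)

/-- The centre of mass of the leading car. -/
def comY (p : Params) (q : Coord n) : ℝ := q.2.1 + p.a * Real.sin (ang q 0)

/-- The velocity `ẋ_i` of body `i` when the configuration `q` moves with velocity `v`. -/
def velX (p : Params) (i : Fin (n + 1)) (q v : Coord n) : ℝ := fderiv ℝ (bodyX p i) q v

/-- The velocity `ẏ_i` of body `i` when the configuration `q` moves with velocity `v`. -/
def velY (p : Params) (i : Fin (n + 1)) (q v : Coord n) : ℝ := fderiv ℝ (bodyY p i) q v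

/-- The constraint distribution: `ẋ_i sin θ_i - ẏ_i cos θ_i = 0` for `i = 0, …, n`. -/
def constraintSpace (p : Params) (q : Coord n) : Submodule ℝ (Coord n) where
  carrier := {v | ∀ i : Fin (n + 1),
    velX p i q v * Real.sin (ang q i) - velY p i q v * Real.cos (ang q i) = 0}
  zero_mem' := by
    intro i
    simp [velX, velY]
  add_mem' := by
    intro v w hv hw i
    have h1 := hv i
    have h2 := hw i
    simp only [velX, velY, map_add] at h1 h2 ⊢
    linear_combination h1 + h2
  smul_mem' := by
    intro c v hv i
    have h1 := hv i
    simp only [velX, velY, map_smul, smul_eq_mul] at h1 ⊢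
    linear_combination c * h1

/-! ### Dynamics -/

/-- The Lagrangian (the kinetic energy) of the vehicle. -/
def lagrangian (p : Params) (q v : Coord n) : ℝ :=
  (1 / 2) * (p.J0 * ang v 0 ^ 2
    + p.M * ((fderiv ℝ (comX p) q v) ^ 2 + (fderiv ℝ (comY p) q v) ^ 2)
    + p.J * ∑ i : Fin n, ang v i.succ ^ 2
    + p.m * ∑ i : Fin n, (velX p i.succ q v ^ 2 + velY p i.succ q v ^ 2))

/-- The kinetic energy metric, by polarization of `lagrangian p q v = (1 / 2) * metric p q v v`. -/
def metric (p : Params) (q v w : Coord n) : ℝ :=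
  lagrangian p q (v + w) - lagrangian p q v - lagrangian p q w

/-- `w` is the orthogonal projection of `b` onto the constraint distribution at `q`, with respect to
the kinetic energy metric. -/
def IsOrthProj (p : Params) (q b w : Coord n) : Prop :=
  w ∈ constraintSpace p q ∧ ∀ d ∈ constraintSpace p q, metric p q (b - w) d = 0

/-- The Euler-Lagrange covector `d/dt (∂L/∂q̇) - ∂L/∂q` along the curve `q` at time `t`, evaluated on
the virtual displacement `δ`. -/
def eulerLagrange (p : Params) (q : ℝ → Coord n) (t : ℝ) (δ : Coord n) : ℝ :=
  deriv (fun s => fderiv ℝ (fun v => lagrangian p (q s) v) (deriv q s) δ) t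
    - fderiv ℝ (fun z => lagrangian p z (deriv q t)) (q t) δ

/-- The Lagrange-d'Alembert principle on the time interval `I`: the velocity obeys the constraints,
and the Euler-Lagrange covector annihilates all virtual displacements allowed by them. -/
structure IsMotion (p : Params) (I : Set ℝ) (q : ℝ → Coord n) : Prop where
  contDiffOn : ContDiffOn ℝ 2 q I
  constraint : ∀ t ∈ I, deriv q t ∈ constraintSpace p (q t)
  dAlembert : ∀ t ∈ I, ∀ δ ∈ constraintSpace p (q t), eulerLagrange p q t δ = 0

/-! ### The symmetry and the reduced coordinates -/

/-- The action on configurations of the element of `SE(2)` that is the rotation by the angle `φ`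
followed by the translation by `(r, s)`. -/
def act (φ r s : ℝ) (q : Coord n) : Coord n :=
  (q.1 * Real.cos φ - q.2.1 * Real.sin φ + r, q.1 * Real.sin φ + q.2.1 * Real.cos φ + s,
    fun i => ang q i + φ)

/-- The tangent lift of the action. -/
def actTangent (φ r s : ℝ) (q v : Coord n) : Coord n := fderiv ℝ (act φ r s) q v

/-- The angles `α_k = θ_{k-1} - θ_k`, `k = 1, …, n` (the entry `k : Fin n` is `α_{k+1}`). -/
def shape (q : Coord n) : Fin n → ℝ := fun k => ang q k.castSucc - ang q k.succ

/-- The component `u = ẋ cos θ + ẏ sin θ` of the velocity of the leading car along its axis. -/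
def speed (q v : Coord n) : ℝ := v.1 * Real.cos (ang q 0) + v.2.1 * Real.sin (ang q 0)

/-- The angular velocity `ω = θ̇` of the leading car. -/
def spin (v : Coord n) : ℝ := ang v 0

/-- The change of coordinates `(x, y, θ, α_1, …, α_n) ↦ (x, y, θ_0, …, θ_n)`, that is `θ_0 = θ` and
`θ_k = θ_{k-1} - α_k`. It is linear, so that it also changes the coordinates of velocities. -/
def ofShape (x y θ : ℝ) (α : Fin n → ℝ) : Coord n :=
  (x, y, fun i => Fin.induction (motive := fun _ => ℝ) θ (fun j θj => θj - α j) i)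

/-! ### The coefficients of the reduced equations -/

/-- `al α k` is `α_k` for `k = 1, …, n`, and `0` for other `k`; in particular `α_0 = 0`. -/
def al (α : Fin n → ℝ) (k : ℕ) : ℝ :=
  if h : 1 ≤ k ∧ k ≤ n then α ⟨k - 1, by omega⟩ else 0

/-- The coefficient `A_k`, `k = 1, …, n`. -/
def coeffA (p : Params) (α : Fin n → ℝ) (k : ℕ) : ℝ :=
  (1 / p.ℓ) * (∏ j ∈ Finset.Icc 1 (k - 2), Real.cos (al α j)) *
    (Real.sin (al α (k - 1)) - Real.cos (al α (k - 1)) * Real.sin (al α k))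

/-- The function `Q(α)`. -/
def fnQ (p : Params) (α : Fin n → ℝ) : ℝ :=
  Real.cos (al α 1) * Real.sin (al α 1) *
    (p.m * p.ℓ ^ 2 * ∑ j ∈ Finset.Icc 1 n, ∏ k ∈ Finset.Icc 2 j, Real.cos (al α k) ^ 2
      - p.J * ∏ k ∈ Finset.Icc 2 n, Real.cos (al α k) ^ 2)

/-- The function `R(α)`. -/
def fnR (p : Params) (α : Fin n → ℝ) : ℝ :=
  p.M + p.m * (∑ j ∈ Finset.Icc 1 n, ∏ k ∈ Finset.Icc 1 j, Real.cos (al α k) ^ 2)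
    + p.J / p.ℓ ^ 2 * (1 - ∏ k ∈ Finset.Icc 1 n, Real.cos (al α k) ^ 2)

/-- The partial derivative of `R` with respect to the entry `k` of `α`, that is `∂R/∂α_{k+1}`. -/
def partialR (p : Params) (α : Fin n → ℝ) (k : Fin n) : ℝ :=
  fderiv ℝ (fnR p) α (Pi.single k 1)

/-- The vector field `Z_1 = cos θ ∂/∂x + sin θ ∂/∂y + ∑ A_k ∂/∂α_k`. -/
def fieldZ1 (p : Params) (q : Coord n) : Coord n :=
  ofShape (Real.cos (ang q 0)) (Real.sin (ang q 0)) 0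
    (fun k : Fin n => coeffA p (shape q) (k.val + 1))

/-- The vector field `Z_2 = ∂/∂θ + ∂/∂α_1`. -/
def fieldZ2 (_q : Coord n) : Coord n :=
  ofShape 0 0 1 (fun k : Fin n => if k.val = 0 then 1 else 0)

/-- The reduced equations of motion on the time interval `I`. -/
structure IsReducedSolution (p : Params) (I : Set ℝ) (u ω : ℝ → ℝ) (α : ℝ → Fin n → ℝ) :
    Prop where
  eq_u : ∀ t ∈ I, HasDerivAt u
    (-(1 / (2 * fnR p (α t)) *
          (∑ k : Fin n, coeffA p (α t) (k.val + 1) * partialR p (α t) k)) * u t ^ 2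
      + fnQ p (α t) / (p.ℓ ^ 2 * fnR p (α t)) * (u t * ω t)
      + p.M * p.a / fnR p (α t) * ω t ^ 2) t
  eq_ω : ∀ t ∈ I, HasDerivAt ω (-(p.M * p.a * u t * ω t / (p.J0 + p.M * p.a ^ 2))) t
  eq_α_one : ∀ t ∈ I, 1 ≤ n →
    HasDerivAt (fun s => al (α s) 1) (ω t - u t * Real.sin (al (α t) 1) / p.ℓ) t
  eq_α : ∀ t ∈ I, ∀ k : ℕ, 2 ≤ k → k ≤ n →
    HasDerivAt (fun s => al (α s) k)
      (u t / p.ℓ * (∏ j ∈ Finset.Icc 1 (k - 2), Real.cos (al (α t) j)) *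
        (Real.sin (al (α t) (k - 1)) - Real.cos (al (α t) (k - 1)) * Real.sin (al (α t) k))) t

end NTrailer

end

open NTrailer

/-!
The argument rests on an explicit description of the constrained velocities. If the leading car has
the components `u`, `ω`, the constraints force, body by body, the velocity of body `k` to be
`u c_k (cos θ_k, sin θ_k)` with `c_k = cos α_1 ⋯ cos α_k` (`relSpeed`), and the angular velocity of
trailer `k` to be `u g_k` with `g_k = c_{k-1} sin α_k / ℓ` (`turnRate`). Since `A_k = g_{k-1} - g_k`,
this is the statement that `Z_1`, `Z_2` span the distribution; in the coordinates
`(x, y, θ_0, …, θ_n)` one has `Z_2 = ∂/∂θ_0`, which moves none of the bodies' axis midpoints. Summing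
squares, and telescoping `g_k² = (c_{k-1}² - c_k²) / ℓ²`, gives `R = M + m ∑ c_k² + J ∑ g_k²`
(`fnR_eq_sum`) and the constrained Lagrangian.

The function `Q` enters through one identity, `∂R/∂α_1 = -2 Q / ℓ²` (`sum_partialR_first`), as
`α_1` occurs in `R` only through `cos² α_1`. The velocities of the trailers as linear functions of
the generalized velocity do not involve `θ_0`, so the inner product of `[Z_1, Z_2] = -∂Z_1/∂θ_0` with
`Z_1` is `-½ ∂R/∂α_1` (`metric_fderiv_fieldZ1`).

For the dynamics, the kinetic energy has the form `½ ∑ w_a (dφ_a/dt)²` with functions `φ_a` of the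
configuration, and symmetry of second derivatives turns the Euler-Lagrange covector into
`∑ w_a (d²φ_a/dt²) dφ_a` (`eulerLagrange_eq_sum`). Evaluated on `Z_1` this is
`R u̇ + ½ Ṙ u - M a ω²`, and on `Z_2` it is `(J_0 + M a²) ω̇ + M a u ω`; with
`Ṙ = u ∑ A_k ∂R/∂α_k - 2 ω Q / ℓ²` these are the reduced equations (`dAlembert_iff`). Conversely, a
reduced solution is lifted by quadratures: first `θ_0` from `ω`, then `x` and `y` from `u` and `θ_0`.
-/

noncomputable section

namespace NTrailer

variable {n : ℕ}

/-! ### Reduced kinematic functions -/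

/-- The ratio `∏_{j=1}^k cos α_j` of the speed of body `k` along its axis to the speed of the
leading car, for motions compatible with the constraints. -/
def relSpeed (α : Fin n → ℝ) (k : ℕ) : ℝ := ∏ j ∈ Finset.Icc 1 k, Real.cos (al α j)

/-- The angular velocity of trailer `k` when the leading car moves with unit speed. The value at
`k = 0` is `0`, because `al α 0 = 0`. -/
def turnRate (p : Params) (α : Fin n → ℝ) (k : ℕ) : ℝ :=
  1 / p.ℓ * (relSpeed α (k - 1) * Real.sin (al α k))

@[simp] lemma al_zero (α : Fin n → ℝ) : al α 0 = 0 := by simp [al]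

lemma al_succ (α : Fin n → ℝ) (k : Fin n) : al α (k.val + 1) = α k := by
  have : 1 ≤ k.val + 1 ∧ k.val + 1 ≤ n := ⟨by omega, k.isLt⟩
  simp [al, this]

lemma al_of_lt (α : Fin n → ℝ) {k : ℕ} (h : n < k) : al α k = 0 := by
  simp only [al]
  rw [dif_neg (by omega)]

@[simp] lemma relSpeed_zero (α : Fin n → ℝ) : relSpeed α 0 = 1 := by simp [relSpeed]

lemma relSpeed_succ (α : Fin n → ℝ) (k : ℕ) :
    relSpeed α (k + 1) = relSpeed α k * Real.cos (al α (k + 1)) := by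
  simp [relSpeed, Finset.prod_Icc_succ_top]

@[simp] lemma turnRate_zero (p : Params) (α : Fin n → ℝ) : turnRate p α 0 = 0 := by
  simp [turnRate]

lemma turnRate_succ (p : Params) (α : Fin n → ℝ) (k : ℕ) :
    turnRate p α (k + 1) = 1 / p.ℓ * (relSpeed α k * Real.sin (al α (k + 1))) := rfl

lemma coeffA_succ (p : Params) (α : Fin n → ℝ) (k : ℕ) :
    coeffA p α (k + 1) = turnRate p α k - turnRate p α (k + 1) := by
  rcases k with _ | k
  · simp [coeffA, turnRate]
  · have h : coeffA p α (k + 1 + 1) = 1 / p.ℓ * relSpeed α k *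
        (Real.sin (al α (k + 1)) - Real.cos (al α (k + 1)) * Real.sin (al α (k + 1 + 1))) := rfl
    rw [h, turnRate_succ, turnRate_succ, relSpeed_succ]
    ring

lemma fnR_eq_sum (p : Params) (α : Fin n → ℝ) :
    fnR p α = p.M + p.m * ∑ i : Fin n, relSpeed α (i.val + 1) ^ 2
      + p.J * ∑ i : Fin n, turnRate p α (i.val + 1) ^ 2 := by
  have h1 : ∑ j ∈ Finset.Icc 1 n, ∏ k ∈ Finset.Icc 1 j, Real.cos (al α k) ^ 2
      = ∑ i : Fin n, relSpeed α (i.val + 1) ^ 2 := by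
    rw [Fin.sum_univ_eq_sum_range (fun i => relSpeed α (i + 1) ^ 2) n, Finset.range_eq_Ico,
      Finset.sum_Ico_add' (fun i => relSpeed α i ^ 2) 0 n 1]
    simp only [relSpeed, Finset.prod_pow, zero_add]
    rfl
  -- `sin² = 1 - cos²` makes the sum of the squared turning rates telescope
  have h2 : ∑ i : Fin n, turnRate p α (i.val + 1) ^ 2
      = 1 / p.ℓ ^ 2 * (1 - ∏ k ∈ Finset.Icc 1 n, Real.cos (al α k) ^ 2) := by
    rw [Fin.sum_univ_eq_sum_range (fun i => turnRate p α (i + 1) ^ 2) n, Finset.prod_pow]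
    have h3 : ∀ i ∈ Finset.range n, turnRate p α (i + 1) ^ 2
        = 1 / p.ℓ ^ 2 * (relSpeed α i ^ 2 - relSpeed α (i + 1) ^ 2) := by
      intro i _
      rw [turnRate_succ, relSpeed_succ]
      have := Real.sin_sq (al α (i + 1))
      linear_combination (1 / p.ℓ ^ 2 * relSpeed α i ^ 2) * this
    rw [Finset.sum_congr rfl h3, ← Finset.mul_sum,
      Finset.sum_range_sub' (fun i => relSpeed α i ^ 2) n]
    simp [relSpeed]
  rw [h2, fnR, h1]
  ring

lemma fnR_pos (p : Params) (hM : 0 < p.M) (hm : 0 ≤ p.m) (hJ : 0 ≤ p.J) (α : Fin n → ℝ) :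
    0 < fnR p α := by
  rw [fnR_eq_sum]
  positivity

@[fun_prop] lemma contDiff_al (k : ℕ) {r : WithTop ℕ∞} :
    ContDiff ℝ r (fun α : Fin n → ℝ => al α k) := by
  unfold al
  split_ifs <;> fun_prop

@[fun_prop] lemma contDiff_relSpeed (k : ℕ) {r : WithTop ℕ∞} :
    ContDiff ℝ r (fun α : Fin n → ℝ => relSpeed α k) := by
  unfold relSpeed
  exact contDiff_prod fun j _ => (contDiff_al j).cos

@[fun_prop] lemma contDiff_turnRate (p : Params) (k : ℕ) {r : WithTop ℕ∞} :
    ContDiff ℝ r (fun α : Fin n → ℝ => turnRate p α k) := by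
  unfold turnRate
  exact contDiff_const.mul ((contDiff_relSpeed _).mul (contDiff_al k).sin)

@[fun_prop] lemma contDiff_fnR (p : Params) {r : WithTop ℕ∞} :
    ContDiff ℝ r (fun α : Fin n → ℝ => fnR p α) := by
  simp only [fnR_eq_sum]
  fun_prop

@[fun_prop] lemma continuous_fnQ (p : Params) : Continuous (fun α : Fin n → ℝ => fnQ p α) := by
  have h (k : ℕ) : Continuous (fun α : Fin n → ℝ => al α k) := (contDiff_al (r := 0) k).continuous
  unfold fnQ
  fun_prop

@[fun_prop] lemma continuous_partialR (p : Params) (k : Fin n) :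
    Continuous (fun α : Fin n → ℝ => partialR p α k) := by
  unfold partialR
  exact ((contDiff_fnR (r := 1) p).continuous_fderiv one_ne_zero).clm_apply continuous_const

@[fun_prop] lemma continuous_coeffA (p : Params) (k : Fin n) :
    Continuous (fun α : Fin n → ℝ => coeffA p α (k.val + 1)) := by
  simp only [coeffA_succ]
  exact (contDiff_turnRate (r := 0) p _).continuous.sub (contDiff_turnRate (r := 0) p _).continuous

/-- Since `α_1` enters `R` only through the common factor `cos² α_1`, the function `Q` is, up to a
constant, the derivative of `R` in the direction of `α_1`. The sum also covers `n = 0`, where both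
sides vanish. -/
lemma sum_partialR_first (p : Params) (hℓ : p.ℓ ≠ 0) (α : Fin n → ℝ) :
    ∑ k : Fin n, (if k.val = 0 then 1 else 0) * partialR p α k = -2 * fnQ p α / p.ℓ ^ 2 := by
  rcases n with _ | n
  · simp [fnQ, al_of_lt]
  rw [Fin.sum_univ_succ]
  simp only [Fin.val_zero, if_true, Fin.val_succ, Nat.add_eq_zero_iff, one_ne_zero, and_false,
    if_false, zero_mul, Finset.sum_const_zero, add_zero, one_mul]
  set K : ℝ := p.m * ∑ j ∈ Finset.Icc 1 (n + 1), ∏ k ∈ Finset.Icc 2 j, Real.cos (al α k) ^ 2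
      - p.J / p.ℓ ^ 2 * ∏ k ∈ Finset.Icc 2 (n + 1), Real.cos (al α k) ^ 2 with hK
  have hal1 (s : ℝ) : al (α + s • Pi.single 0 1) 1 = al α 1 + s := by
    simp [al]
  have hal (s : ℝ) (k : ℕ) (hk : 2 ≤ k) : al (α + s • Pi.single 0 1) k = al α k := by
    unfold al
    split_ifs with h
    · have : (⟨k - 1, by omega⟩ : Fin (n + 1)) ≠ 0 := by
        intro h0
        have := congrArg Fin.val h0
        simp at this
        omega
      simp [this]
    · rfl
  have hprod (s : ℝ) (j : ℕ) (hj : 1 ≤ j) :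
      ∏ k ∈ Finset.Icc 1 j, Real.cos (al (α + s • Pi.single 0 1) k) ^ 2
        = Real.cos (al α 1 + s) ^ 2 * ∏ k ∈ Finset.Icc 2 j, Real.cos (al α k) ^ 2 := by
    rw [← Finset.mul_prod_Ioc_eq_prod_Icc hj, hal1]
    congr 1
    refine Finset.prod_congr rfl fun k hk => ?_
    rw [hal s k (Finset.mem_Icc.mp hk).1]
  have hR (s : ℝ) : fnR p (α + s • Pi.single 0 1)
      = p.M + p.J / p.ℓ ^ 2 + Real.cos (al α 1 + s) ^ 2 * K := by
    have hsum : ∑ j ∈ Finset.Icc 1 (n + 1), ∏ k ∈ Finset.Icc 1 j,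
          Real.cos (al (α + s • Pi.single 0 1) k) ^ 2
        = Real.cos (al α 1 + s) ^ 2 *
          ∑ j ∈ Finset.Icc 1 (n + 1), ∏ k ∈ Finset.Icc 2 j, Real.cos (al α k) ^ 2 := by
      rw [Finset.mul_sum]
      exact Finset.sum_congr rfl fun j hj => hprod s j (Finset.mem_Icc.mp hj).1
    rw [fnR, hsum, hprod s (n + 1) (by omega), hK]
    ring
  have hline : HasDerivAt (fun s : ℝ => fnR p (α + s • Pi.single 0 1)) (partialR p α 0) 0 := by
    have h := ((contDiff_fnR (r := 1) p).differentiable one_ne_zero α).hasFDerivAt.hasLineDerivAt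
      (Pi.single 0 1)
    exact h
  have hline' : HasDerivAt (fun s : ℝ => fnR p (α + s • Pi.single 0 1))
      (-2 * Real.cos (al α 1) * Real.sin (al α 1) * K) 0 := by
    rw [funext hR]
    have h := ((((hasDerivAt_id (0 : ℝ)).const_add (al α 1)).cos.pow 2).mul_const K).const_add
      (p.M + p.J / p.ℓ ^ 2)
    refine h.congr_deriv ?_
    simp
  rw [hline.unique hline', fnQ, hK]
  field_simp

/-! ### Velocities of the bodies -/

@[fun_prop] lemma contDiff_ang (i : Fin (n + 1)) {r : WithTop ℕ∞} :
    ContDiff ℝ r (fun q : Coord n => ang q i) := by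
  unfold ang
  fun_prop

@[simp] lemma ang_add (v w : Coord n) (i : Fin (n + 1)) : ang (v + w) i = ang v i + ang w i := rfl

@[simp] lemma ang_smul (c : ℝ) (v : Coord n) (i : Fin (n + 1)) : ang (c • v) i = c * ang v i := rfl

lemma coord_ext {v w : Coord n} (h1 : v.1 = w.1) (h2 : v.2.1 = w.2.1)
    (h3 : ∀ i, ang v i = ang w i) : v = w :=
  Prod.ext h1 (Prod.ext h2 (funext h3))

/-- The projection to the angle `θ_i` as a continuous linear map. -/
def angCLM (i : Fin (n + 1)) : Coord n →L[ℝ] ℝ :=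
  (ContinuousLinearMap.proj i).comp
    ((ContinuousLinearMap.snd ℝ ℝ (Fin (n + 1) → ℝ)).comp
      (ContinuousLinearMap.snd ℝ ℝ (ℝ × (Fin (n + 1) → ℝ))))

@[simp] lemma angCLM_apply (i : Fin (n + 1)) (q : Coord n) : angCLM i q = ang q i := rfl

lemma hasFDerivAt_ang (i : Fin (n + 1)) (q : Coord n) :
    HasFDerivAt (fun q : Coord n => ang q i) (angCLM i) q :=
  (angCLM i).hasFDerivAt

lemma bodyX_succ (p : Params) (j : Fin n) :
    bodyX p j.succ = fun q : Coord n => bodyX p j.castSucc q - p.ℓ * Real.cos (ang q j.succ) := rfl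

lemma bodyY_succ (p : Params) (j : Fin n) :
    bodyY p j.succ = fun q : Coord n => bodyY p j.castSucc q - p.ℓ * Real.sin (ang q j.succ) := rfl

lemma contDiff_bodyX (p : Params) (i : Fin (n + 1)) {r : WithTop ℕ∞} :
    ContDiff ℝ r (bodyX p i) := by
  induction i using Fin.induction with
  | zero => exact contDiff_fst
  | succ j ih =>
    rw [bodyX_succ]
    exact ih.sub (contDiff_const.mul (contDiff_ang _).cos)

lemma contDiff_bodyY (p : Params) (i : Fin (n + 1)) {r : WithTop ℕ∞} :
    ContDiff ℝ r (bodyY p i) := by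
  induction i using Fin.induction with
  | zero => exact contDiff_snd.fst
  | succ j ih =>
    rw [bodyY_succ]
    exact ih.sub (contDiff_const.mul (contDiff_ang _).sin)

lemma contDiff_comX (p : Params) {r : WithTop ℕ∞} : ContDiff ℝ r (comX (n := n) p) := by
  unfold comX
  exact contDiff_fst.add (contDiff_const.mul (contDiff_ang _).cos)

lemma contDiff_comY (p : Params) {r : WithTop ℕ∞} : ContDiff ℝ r (comY (n := n) p) := by
  unfold comY
  exact contDiff_snd.fst.add (contDiff_const.mul (contDiff_ang _).sin)

/-- The projection to the coordinate `x` as a continuous linear map. -/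
def xCLM : Coord n →L[ℝ] ℝ := ContinuousLinearMap.fst ℝ ℝ (ℝ × (Fin (n + 1) → ℝ))

/-- The projection to the coordinate `y` as a continuous linear map. -/
def yCLM : Coord n →L[ℝ] ℝ :=
  (ContinuousLinearMap.fst ℝ ℝ (Fin (n + 1) → ℝ)).comp
    (ContinuousLinearMap.snd ℝ ℝ (ℝ × (Fin (n + 1) → ℝ)))

@[simp] lemma xCLM_apply (q : Coord n) : xCLM q = q.1 := rfl

@[simp] lemma yCLM_apply (q : Coord n) : yCLM q = q.2.1 := rfl

lemma hasFDerivAt_x (q : Coord n) : HasFDerivAt (fun q : Coord n => q.1) xCLM q :=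
  xCLM.hasFDerivAt

lemma hasFDerivAt_y (q : Coord n) : HasFDerivAt (fun q : Coord n => q.2.1) yCLM q :=
  yCLM.hasFDerivAt

@[simp] lemma velX_zero (p : Params) (q v : Coord n) : velX p 0 q v = v.1 := by
  have h : HasFDerivAt (bodyX p 0) xCLM q := hasFDerivAt_x q
  rw [velX, h.fderiv, xCLM_apply]

@[simp] lemma velY_zero (p : Params) (q v : Coord n) : velY p 0 q v = v.2.1 := by
  have h : HasFDerivAt (bodyY p 0) yCLM q := hasFDerivAt_y q
  rw [velY, h.fderiv, yCLM_apply]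

lemma velX_succ (p : Params) (j : Fin n) (q v : Coord n) :
    velX p j.succ q v
      = velX p j.castSucc q v + p.ℓ * Real.sin (ang q j.succ) * ang v j.succ := by
  have h1 := ((contDiff_bodyX (r := 1) p j.castSucc).differentiable one_ne_zero q).hasFDerivAt
  have h2 := h1.fun_sub ((hasFDerivAt_ang j.succ q).cos.const_mul p.ℓ)
  rw [velX, bodyX_succ, h2.fderiv]
  simp [velX]
  ring

lemma velY_succ (p : Params) (j : Fin n) (q v : Coord n) :
    velY p j.succ q v
      = velY p j.castSucc q v - p.ℓ * Real.cos (ang q j.succ) * ang v j.succ := by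
  have h1 := ((contDiff_bodyY (r := 1) p j.castSucc).differentiable one_ne_zero q).hasFDerivAt
  have h2 := h1.fun_sub ((hasFDerivAt_ang j.succ q).sin.const_mul p.ℓ)
  rw [velY, bodyY_succ, h2.fderiv]
  simp [velY]
  ring

lemma fderiv_comX (p : Params) (q v : Coord n) :
    fderiv ℝ (comX p) q v = v.1 - p.a * Real.sin (ang q 0) * ang v 0 := by
  have h2 : HasFDerivAt (comX p) _ q := (hasFDerivAt_x q).add ((hasFDerivAt_ang 0 q).cos.const_mul p.a)
  rw [h2.fderiv]
  simp
  ring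

lemma fderiv_comY (p : Params) (q v : Coord n) :
    fderiv ℝ (comY p) q v = v.2.1 + p.a * Real.cos (ang q 0) * ang v 0 := by
  have h2 : HasFDerivAt (comY p) _ q := (hasFDerivAt_y q).add ((hasFDerivAt_ang 0 q).sin.const_mul p.a)
  rw [h2.fderiv]
  simp
  ring

lemma velX_add (p : Params) (i : Fin (n + 1)) (q v w : Coord n) :
    velX p i q (v + w) = velX p i q v + velX p i q w := map_add _ _ _

lemma velY_add (p : Params) (i : Fin (n + 1)) (q v w : Coord n) :
    velY p i q (v + w) = velY p i q v + velY p i q w := map_add _ _ _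

lemma velX_smul (p : Params) (i : Fin (n + 1)) (q : Coord n) (c : ℝ) (v : Coord n) :
    velX p i q (c • v) = c * velX p i q v := map_smul _ _ _

lemma velY_smul (p : Params) (i : Fin (n + 1)) (q : Coord n) (c : ℝ) (v : Coord n) :
    velY p i q (c • v) = c * velY p i q v := map_smul _ _ _

/-- The velocities of the bodies depend on the configuration only through the trailer angles, and
on these only through their sines and cosines. -/
lemma vel_congr (p : Params) {q q' : Coord n}
    (hc : ∀ j : Fin n, Real.cos (ang q j.succ) = Real.cos (ang q' j.succ))
    (hs : ∀ j : Fin n, Real.sin (ang q j.succ) = Real.sin (ang q' j.succ))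
    (i : Fin (n + 1)) (v : Coord n) :
    velX p i q v = velX p i q' v ∧ velY p i q v = velY p i q' v := by
  induction i using Fin.induction with
  | zero => simp
  | succ j ih => rw [velX_succ, velX_succ, velY_succ, velY_succ, ih.1, ih.2, hc, hs]; simp

/-! ### Changing to shape coordinates -/

@[simp] lemma ofShape_fst (x y θ : ℝ) (α : Fin n → ℝ) : (ofShape x y θ α).1 = x := rfl

@[simp] lemma ofShape_snd_fst (x y θ : ℝ) (α : Fin n → ℝ) : (ofShape x y θ α).2.1 = y := rfl

@[simp] lemma ang_ofShape_zero (x y θ : ℝ) (α : Fin n → ℝ) : ang (ofShape x y θ α) 0 = θ := rfl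

lemma ang_ofShape_succ (x y θ : ℝ) (α : Fin n → ℝ) (j : Fin n) :
    ang (ofShape x y θ α) j.succ = ang (ofShape x y θ α) j.castSucc - α j := rfl

@[simp] lemma shape_ofShape (x y θ : ℝ) (α : Fin n → ℝ) : shape (ofShape x y θ α) = α := by
  funext j
  rw [shape, ang_ofShape_succ]
  ring

lemma ofShape_shape (q : Coord n) : ofShape q.1 q.2.1 (ang q 0) (shape q) = q := by
  refine coord_ext rfl rfl fun i => ?_
  induction i using Fin.induction with
  | zero => rfl
  | succ j ih =>
    rw [ang_ofShape_succ, ih, shape]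
    ring

/-- A coordinate vector is determined by its shape coordinates. -/
lemma coord_ext_shape {v w : Coord n} (h1 : v.1 = w.1) (h2 : v.2.1 = w.2.1)
    (h3 : ang v 0 = ang w 0) (h4 : shape v = shape w) : v = w := by
  rw [← ofShape_shape v, ← ofShape_shape w, h1, h2, h3, h4]

lemma shape_add (v w : Coord n) : shape (v + w) = shape v + shape w := by
  funext j
  simp [shape]
  ring

lemma shape_smul (c : ℝ) (v : Coord n) : shape (c • v) = c • shape v := by
  funext j
  simp [shape]
  ring

/-- The change of coordinates `ofShape` as a continuous linear map. -/
def ofShapeCLM : (ℝ × ℝ × ℝ × (Fin n → ℝ)) →L[ℝ] Coord n :=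
  LinearMap.toContinuousLinearMap
    { toFun := fun z => ofShape z.1 z.2.1 z.2.2.1 z.2.2.2
      map_add' := fun z w => coord_ext_shape rfl rfl rfl (by simp [shape_add])
      map_smul' := fun c z => coord_ext_shape rfl rfl rfl (by simp [shape_smul]) }

lemma ofShapeCLM_apply (x y θ : ℝ) (α : Fin n → ℝ) :
    ofShapeCLM (x, y, θ, α) = ofShape x y θ α := rfl

lemma al_shape_succ (q : Coord n) (j : Fin n) :
    al (shape q) (j.val + 1) = ang q j.castSucc - ang q j.succ := al_succ _ _

lemma contDiff_shape {r : WithTop ℕ∞} : ContDiff ℝ r (shape (n := n)) := by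
  rw [contDiff_pi]
  exact fun k => (contDiff_ang _).sub (contDiff_ang _)

/-! ### The fields spanning the constraint distribution -/

@[simp] lemma fieldZ1_fst (p : Params) (q : Coord n) : (fieldZ1 p q).1 = Real.cos (ang q 0) := rfl

@[simp] lemma fieldZ1_snd_fst (p : Params) (q : Coord n) :
    (fieldZ1 p q).2.1 = Real.sin (ang q 0) := rfl

lemma ang_fieldZ1 (p : Params) (q : Coord n) (i : Fin (n + 1)) :
    ang (fieldZ1 p q) i = turnRate p (shape q) i.val := by
  induction i using Fin.induction with
  | zero => simp [fieldZ1]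
  | succ j ih =>
    rw [fieldZ1, ang_ofShape_succ, ← fieldZ1, ih, coeffA_succ]
    simp

@[simp] lemma ang_fieldZ1_zero (p : Params) (q : Coord n) : ang (fieldZ1 p q) 0 = 0 := rfl

@[simp] lemma fieldZ2_fst (q : Coord n) : (fieldZ2 q).1 = 0 := rfl

@[simp] lemma fieldZ2_snd_fst (q : Coord n) : (fieldZ2 q).2.1 = 0 := rfl

@[simp] lemma ang_fieldZ2_zero (q : Coord n) : ang (fieldZ2 q) 0 = 1 := rfl

/-- In the coordinates `(x, y, θ_0, …, θ_n)` the field `Z_2` is `∂/∂θ_0`. -/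
@[simp] lemma ang_fieldZ2_succ (q : Coord n) (j : Fin n) : ang (fieldZ2 q) j.succ = 0 := by
  have h : ∀ i : Fin (n + 1), ang (fieldZ2 q) i = if i.val = 0 then 1 else 0 := by
    intro i
    induction i using Fin.induction with
    | zero => rfl
    | succ j ih =>
      rw [fieldZ2, ang_ofShape_succ, ← fieldZ2, ih]
      simp
  simp [h]

lemma shape_fieldZ1 (p : Params) (q : Coord n) :
    shape (fieldZ1 p q) = fun k : Fin n => coeffA p (shape q) (k.val + 1) := shape_ofShape _ _ _ _

lemma shape_fieldZ2 (q : Coord n) :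
    shape (fieldZ2 q) = fun k : Fin n => if k.val = 0 then 1 else 0 := shape_ofShape _ _ _ _

lemma contDiff_fieldZ1 (p : Params) {r : WithTop ℕ∞} : ContDiff ℝ r (fieldZ1 (n := n) p) := by
  have h0 := contDiff_ang (n := n) 0 (r := r)
  have h : ContDiff ℝ r fun q : Coord n => ((Real.cos (ang q 0), Real.sin (ang q 0), (0 : ℝ),
      fun k : Fin n => coeffA p (shape q) (k.val + 1)) : ℝ × ℝ × ℝ × (Fin n → ℝ)) := by
    refine h0.cos.prodMk (h0.sin.prodMk (contDiff_const.prodMk (contDiff_pi.mpr fun k => ?_)))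
    simp only [coeffA_succ]
    exact ((contDiff_turnRate p _).comp contDiff_shape).sub
      ((contDiff_turnRate p _).comp contDiff_shape)
  exact ofShapeCLM.contDiff.comp h

/-- Along a motion with unit speed and without rotation of the leading car, body `i` moves along its
axis with speed `relSpeed`. -/
lemma vel_fieldZ1 (p : Params) (hℓ : p.ℓ ≠ 0) (q : Coord n) (i : Fin (n + 1)) :
    velX p i q (fieldZ1 p q) = relSpeed (shape q) i.val * Real.cos (ang q i) ∧
    velY p i q (fieldZ1 p q) = relSpeed (shape q) i.val * Real.sin (ang q i) := by
  induction i using Fin.induction with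
  | zero => simp
  | succ j ih =>
    rw [velX_succ, velY_succ, ih.1, ih.2, ang_fieldZ1]
    simp only [Fin.val_succ, Fin.val_castSucc, turnRate_succ, relSpeed_succ, al_shape_succ]
    rw [Real.sin_sub, Real.cos_sub]
    have := Real.sin_sq_add_cos_sq (ang q j.succ)
    constructor
    · field_simp
      linear_combination (-relSpeed (shape q) j.val * Real.cos (ang q j.castSucc)) * this
    · field_simp
      linear_combination (-relSpeed (shape q) j.val * Real.sin (ang q j.castSucc)) * this

lemma vel_fieldZ2 (p : Params) (q q' : Coord n) (i : Fin (n + 1)) :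
    velX p i q (fieldZ2 q') = 0 ∧ velY p i q (fieldZ2 q') = 0 := by
  induction i using Fin.induction with
  | zero => simp
  | succ j ih => simp [velX_succ, velY_succ, ih.1, ih.2]

lemma mem_constraintSpace (p : Params) (q v : Coord n) : v ∈ constraintSpace p q ↔
    ∀ i : Fin (n + 1),
      velX p i q v * Real.sin (ang q i) - velY p i q v * Real.cos (ang q i) = 0 := Iff.rfl

lemma fieldZ1_mem (p : Params) (hℓ : p.ℓ ≠ 0) (q : Coord n) :
    fieldZ1 p q ∈ constraintSpace p q := by
  intro i
  rw [(vel_fieldZ1 p hℓ q i).1, (vel_fieldZ1 p hℓ q i).2]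
  ring

lemma fieldZ2_mem (p : Params) (q q' : Coord n) : fieldZ2 q' ∈ constraintSpace p q := by
  intro i
  rw [(vel_fieldZ2 p q q' i).1, (vel_fieldZ2 p q q' i).2]
  ring

/-- The constraints determine a velocity from its components `u` and `ω`: a velocity that obeys
them and has `u = ω = 0` vanishes. -/
lemma eq_zero_of_mem (p : Params) (hℓ : p.ℓ ≠ 0) (q v : Coord n) (hv : v ∈ constraintSpace p q)
    (hu : speed q v = 0) (hω : spin v = 0) : v = 0 := by
  have h0 := hv 0
  simp only [velX_zero, velY_zero] at h0
  have hcs := Real.sin_sq_add_cos_sq (ang q 0)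
  unfold speed at hu
  have hx : v.1 = 0 := by
    linear_combination (-v.1) * hcs + Real.cos (ang q 0) * hu + Real.sin (ang q 0) * h0
  have hy : v.2.1 = 0 := by
    linear_combination (-v.2.1) * hcs + Real.sin (ang q 0) * hu - Real.cos (ang q 0) * h0
  have key : ∀ i : Fin (n + 1), velX p i q v = 0 ∧ velY p i q v = 0 ∧ ang v i = 0 := by
    intro i
    induction i using Fin.induction with
    | zero => exact ⟨by simpa using hx, by simpa using hy, hω⟩
    | succ j ih =>
      have hj := hv j.succ
      have hcs := Real.sin_sq_add_cos_sq (ang q j.succ)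
      rw [velX_succ, velY_succ, ih.1, ih.2.1] at hj
      have ha : ang v j.succ = 0 := by
        refine (mul_eq_zero.mp ?_).resolve_left hℓ
        linear_combination hj - (p.ℓ * ang v j.succ) * hcs
      rw [velX_succ, velY_succ, ih.1, ih.2.1, ha]
      simp
  exact coord_ext hx hy fun i => (key i).2.2

lemma speed_add (q v w : Coord n) : speed q (v + w) = speed q v + speed q w := by
  simp [speed]
  ring

lemma speed_smul (q : Coord n) (c : ℝ) (v : Coord n) : speed q (c • v) = c * speed q v := by
  simp [speed]
  ring

lemma spin_add (v w : Coord n) : spin (v + w) = spin v + spin w := rfl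

lemma spin_smul (c : ℝ) (v : Coord n) : spin (c • v) = c * spin v := rfl

@[simp] lemma speed_fieldZ1 (p : Params) (q : Coord n) : speed q (fieldZ1 p q) = 1 := by
  have := Real.sin_sq_add_cos_sq (ang q 0)
  simp [speed]
  linear_combination this

@[simp] lemma speed_fieldZ2 (q q' : Coord n) : speed q (fieldZ2 q') = 0 := by simp [speed]

@[simp] lemma spin_fieldZ1 (p : Params) (q : Coord n) : spin (fieldZ1 p q) = 0 := rfl

@[simp] lemma spin_fieldZ2 (q : Coord n) : spin (fieldZ2 q) = 1 := rfl

lemma speed_combination (p : Params) (q : Coord n) (u ω : ℝ) :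
    speed q (u • fieldZ1 p q + ω • fieldZ2 q) = u := by
  simp [speed_add, speed_smul]

lemma spin_combination (p : Params) (q : Coord n) (u ω : ℝ) :
    spin (u • fieldZ1 p q + ω • fieldZ2 q) = ω := by
  simp [spin_add, spin_smul]

lemma combination_mem (p : Params) (hℓ : p.ℓ ≠ 0) (q : Coord n) (u ω : ℝ) :
    u • fieldZ1 p q + ω • fieldZ2 q ∈ constraintSpace p q :=
  add_mem (Submodule.smul_mem _ _ (fieldZ1_mem p hℓ q)) (Submodule.smul_mem _ _ (fieldZ2_mem p q q))

lemma eq_of_mem (p : Params) (hℓ : p.ℓ ≠ 0) (q v w : Coord n) (hv : v ∈ constraintSpace p q)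
    (hw : w ∈ constraintSpace p q) (hu : speed q v = speed q w) (hω : spin v = spin w) :
    v = w := by
  refine sub_eq_zero.mp (eq_zero_of_mem p hℓ q _ (sub_mem hv hw) ?_ ?_)
  · simp only [speed, Prod.fst_sub, Prod.snd_sub] at hu ⊢
    linear_combination hu
  · exact sub_eq_zero.mpr hω

lemma eq_combination (p : Params) (hℓ : p.ℓ ≠ 0) (q v : Coord n) (hv : v ∈ constraintSpace p q) :
    v = speed q v • fieldZ1 p q + spin v • fieldZ2 q :=
  eq_of_mem p hℓ q _ _ hv (combination_mem p hℓ q _ _) (speed_combination p q _ _).symm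
    (spin_combination p q _ _).symm

lemma linearIndependent_fields (p : Params) (q : Coord n) :
    LinearIndependent ℝ ![fieldZ1 p q, fieldZ2 q] := by
  rw [LinearIndependent.pair_iff]
  intro u ω h
  have h1 := speed_combination p q u ω
  have h2 := spin_combination p q u ω
  rw [h] at h1 h2
  exact ⟨by simpa [speed] using h1.symm, by simpa [spin, ang] using h2.symm⟩

lemma span_fields (p : Params) (hℓ : p.ℓ ≠ 0) (q : Coord n) :
    Submodule.span ℝ {fieldZ1 p q, fieldZ2 q} = constraintSpace p q := by
  refine le_antisymm (Submodule.span_le.mpr ?_) fun v hv => ?_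
  · rintro v (rfl | rfl)
    · exact fieldZ1_mem p hℓ q
    · exact fieldZ2_mem p q q
  · exact Submodule.mem_span_pair.mpr ⟨_, _, (eq_combination p hℓ q v hv).symm⟩

/-! ### Symmetry and the reduced space -/

lemma cos_eq_of_coe_eq {x y : ℝ} (h : (x : Real.Angle) = (y : Real.Angle)) :
    Real.cos x = Real.cos y := by
  rw [← Real.Angle.cos_coe, h, Real.Angle.cos_coe]

lemma sin_eq_of_coe_eq {x y : ℝ} (h : (x : Real.Angle) = (y : Real.Angle)) :
    Real.sin x = Real.sin y := by
  rw [← Real.Angle.sin_coe, h, Real.Angle.sin_coe]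

lemma SameConfig.vel_eq (p : Params) {q q' : Coord n} (h : SameConfig q q') (i : Fin (n + 1))
    (v : Coord n) : velX p i q v = velX p i q' v ∧ velY p i q v = velY p i q' v :=
  vel_congr p (fun j => cos_eq_of_coe_eq (h.2.2 j.succ)) (fun j => sin_eq_of_coe_eq (h.2.2 j.succ))
    i v

lemma lagrangian_congr (p : Params) {q q' : Coord n} (h : SameConfig q q') (v : Coord n) :
    lagrangian p q v = lagrangian p q' v := by
  simp only [lagrangian, fderiv_comX, fderiv_comY, (h.vel_eq p _ v).1, (h.vel_eq p _ v).2,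
    cos_eq_of_coe_eq (h.2.2 0), sin_eq_of_coe_eq (h.2.2 0)]

lemma constraintSpace_congr (p : Params) {q q' : Coord n} (h : SameConfig q q') :
    constraintSpace p q = constraintSpace p q' := by
  ext v
  simp only [mem_constraintSpace, (h.vel_eq p _ v).1, (h.vel_eq p _ v).2,
    fun i => cos_eq_of_coe_eq (h.2.2 i), fun i => sin_eq_of_coe_eq (h.2.2 i)]

lemma speed_congr {q q' : Coord n} (h : SameConfig q q') (v : Coord n) :
    speed q v = speed q' v := by
  simp only [speed, cos_eq_of_coe_eq (h.2.2 0), sin_eq_of_coe_eq (h.2.2 0)]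

@[simp] lemma ang_act (φ r s : ℝ) (q : Coord n) (i : Fin (n + 1)) :
    ang (act φ r s q) i = ang q i + φ := rfl

lemma actTangent_eq (φ r s : ℝ) (q v : Coord n) :
    actTangent φ r s q v = (v.1 * Real.cos φ - v.2.1 * Real.sin φ,
      v.1 * Real.sin φ + v.2.1 * Real.cos φ, fun i => ang v i) := by
  have hx := hasFDerivAt_x q
  have hy := hasFDerivAt_y q
  have h1 := ((hx.mul_const (Real.cos φ)).sub (hy.mul_const (Real.sin φ))).add_const r
  have h2 := ((hx.mul_const (Real.sin φ)).add (hy.mul_const (Real.cos φ))).add_const s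
  have h3 : HasFDerivAt (fun q : Coord n => fun i => ang q i + φ)
      (ContinuousLinearMap.pi fun i => angCLM i) q :=
    hasFDerivAt_pi.mpr fun i => (hasFDerivAt_ang i q).add_const φ
  have h : HasFDerivAt (act φ r s) _ q := h1.prodMk (h2.prodMk h3)
  rw [actTangent, h.fderiv]
  simp [mul_comm]

@[simp] lemma ang_actTangent (φ r s : ℝ) (q v : Coord n) (i : Fin (n + 1)) :
    ang (actTangent φ r s q v) i = ang v i := by
  rw [actTangent_eq]
  rfl

@[simp] lemma spin_actTangent (φ r s : ℝ) (q v : Coord n) :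
    spin (actTangent φ r s q v) = spin v := ang_actTangent _ _ _ _ _ _

/-- The action rotates the velocities of the bodies. -/
lemma vel_act (p : Params) (φ r s : ℝ) (q v : Coord n) (i : Fin (n + 1)) :
    velX p i (act φ r s q) (actTangent φ r s q v)
      = velX p i q v * Real.cos φ - velY p i q v * Real.sin φ ∧
    velY p i (act φ r s q) (actTangent φ r s q v)
      = velX p i q v * Real.sin φ + velY p i q v * Real.cos φ := by
  induction i using Fin.induction with
  | zero => simp [actTangent_eq]
  | succ j ih =>
    simp only [velX_succ, velY_succ, ih.1, ih.2, ang_act, ang_actTangent, Real.sin_add,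
      Real.cos_add]
    constructor <;> ring

lemma lagrangian_act (p : Params) (φ r s : ℝ) (q v : Coord n) :
    lagrangian p (act φ r s q) (actTangent φ r s q v) = lagrangian p q v := by
  have hφ := Real.sin_sq_add_cos_sq φ
  have hi : ∀ i : Fin (n + 1), velX p i (act φ r s q) (actTangent φ r s q v) ^ 2
      + velY p i (act φ r s q) (actTangent φ r s q v) ^ 2
      = velX p i q v ^ 2 + velY p i q v ^ 2 := by
    intro i
    rw [(vel_act p φ r s q v i).1, (vel_act p φ r s q v i).2]
    linear_combination (velX p i q v ^ 2 + velY p i q v ^ 2) * hφ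
  have hc : fderiv ℝ (comX p) (act φ r s q) (actTangent φ r s q v) ^ 2
      + fderiv ℝ (comY p) (act φ r s q) (actTangent φ r s q v) ^ 2
      = fderiv ℝ (comX p) q v ^ 2 + fderiv ℝ (comY p) q v ^ 2 := by
    simp only [fderiv_comX, fderiv_comY, ang_act, ang_actTangent, Real.sin_add, Real.cos_add]
    simp only [actTangent_eq]
    linear_combination ((v.1 - p.a * Real.sin (ang q 0) * ang v 0) ^ 2
      + (v.2.1 + p.a * Real.cos (ang q 0) * ang v 0) ^ 2) * hφ
  simp only [lagrangian, hi, hc, ang_actTangent]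

lemma actTangent_mem_iff (p : Params) (φ r s : ℝ) (q v : Coord n) :
    actTangent φ r s q v ∈ constraintSpace p (act φ r s q) ↔ v ∈ constraintSpace p q := by
  have hφ := Real.sin_sq_add_cos_sq φ
  have hi : ∀ i : Fin (n + 1),
      velX p i (act φ r s q) (actTangent φ r s q v) * Real.sin (ang (act φ r s q) i)
        - velY p i (act φ r s q) (actTangent φ r s q v) * Real.cos (ang (act φ r s q) i)
      = velX p i q v * Real.sin (ang q i) - velY p i q v * Real.cos (ang q i) := by
    intro i
    rw [(vel_act p φ r s q v i).1, (vel_act p φ r s q v i).2, ang_act, Real.sin_add, Real.cos_add]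
    linear_combination (velX p i q v * Real.sin (ang q i) - velY p i q v * Real.cos (ang q i)) * hφ
  simp only [mem_constraintSpace, hi]

lemma shape_act (φ r s : ℝ) (q : Coord n) : shape (act φ r s q) = shape q := by
  funext k
  simp [shape]

lemma speed_act (φ r s : ℝ) (q v : Coord n) :
    speed (act φ r s q) (actTangent φ r s q v) = speed q v := by
  have hφ := Real.sin_sq_add_cos_sq φ
  simp only [speed, ang_act, Real.cos_add, Real.sin_add, actTangent_eq]
  linear_combination (v.1 * Real.cos (ang q 0) + v.2.1 * Real.sin (ang q 0)) * hφ

lemma coe_shape_eq_of_sameConfig {q q' : Coord n} (h : SameConfig q q') (k : Fin n) :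
    (shape q k : Real.Angle) = (shape q' k : Real.Angle) := by
  simp only [shape, Real.Angle.coe_sub, h.2.2]

/-- Two constrained velocities are related by the action exactly if they have the same shape angles
and the same components `u` and `ω`. -/
lemma exists_act_iff (p : Params) (hℓ : p.ℓ ≠ 0) (q q' v v' : Coord n)
    (hv : v ∈ constraintSpace p q) (hv' : v' ∈ constraintSpace p q') :
    (∃ φ r s : ℝ, SameConfig (act φ r s q) q' ∧ actTangent φ r s q v = v') ↔
      (∀ k, (shape q k : Real.Angle) = (shape q' k : Real.Angle)) ∧
        speed q v = speed q' v' ∧ spin v = spin v' := by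
  constructor
  · rintro ⟨φ, r, s, h, rfl⟩
    refine ⟨fun k => ?_, ?_, (spin_actTangent φ r s q v).symm⟩
    · rw [← coe_shape_eq_of_sameConfig h, shape_act]
    · rw [← speed_congr h, speed_act]
  · rintro ⟨hs, hu, hω⟩
    -- the rotation that aligns the leading cars, followed by the translation that matches them
    set φ := ang q' 0 - ang q 0 with hφ
    set r := q'.1 - (q.1 * Real.cos φ - q.2.1 * Real.sin φ) with hr
    set s := q'.2.1 - (q.1 * Real.sin φ + q.2.1 * Real.cos φ) with hs'
    have h : SameConfig (act φ r s q) q' := by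
      refine ⟨by simp [act, hr], by simp [act, hs'], fun i => ?_⟩
      induction i using Fin.induction with
      | zero => simp [hφ]
      | succ j ih =>
        have hj := hs j
        simp only [shape, ang_act, Real.Angle.coe_sub, Real.Angle.coe_add] at hj ih ⊢
        rw [← ih] at hj
        have h3 : (ang q' j.succ : Real.Angle)
            = ang q j.castSucc + φ - (ang q j.castSucc - ang q j.succ) := by
          rw [hj]
          abel
        rw [h3]
        abel
    refine ⟨φ, r, s, h, eq_of_mem p hℓ q' _ _ ?_ hv' ?_ ?_⟩
    · rw [← constraintSpace_congr p h]
      exact (actTangent_mem_iff p φ r s q v).mpr hv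
    · rw [← speed_congr h, speed_act, hu]
    · rw [spin_actTangent, hω]

/-! ### The kinetic energy metric on the constraint distribution -/

lemma metric_eq (p : Params) (q v w : Coord n) :
    metric p q v w = p.J0 * (ang v 0 * ang w 0)
      + p.M * (fderiv ℝ (comX p) q v * fderiv ℝ (comX p) q w
        + fderiv ℝ (comY p) q v * fderiv ℝ (comY p) q w)
      + p.J * ∑ i : Fin n, ang v i.succ * ang w i.succ
      + p.m * ∑ i : Fin n, (velX p i.succ q v * velX p i.succ q w
        + velY p i.succ q v * velY p i.succ q w) := by
  have h1 : ∑ i : Fin n, ang (v + w) i.succ ^ 2 = ∑ i : Fin n, ang v i.succ ^ 2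
      + ∑ i : Fin n, ang w i.succ ^ 2 + 2 * ∑ i : Fin n, ang v i.succ * ang w i.succ := by
    rw [Finset.mul_sum, ← Finset.sum_add_distrib, ← Finset.sum_add_distrib]
    exact Finset.sum_congr rfl fun i _ => by rw [ang_add]; ring
  have h2 : ∑ i : Fin n, (velX p i.succ q (v + w) ^ 2 + velY p i.succ q (v + w) ^ 2)
      = ∑ i : Fin n, (velX p i.succ q v ^ 2 + velY p i.succ q v ^ 2)
        + ∑ i : Fin n, (velX p i.succ q w ^ 2 + velY p i.succ q w ^ 2)
        + 2 * ∑ i : Fin n, (velX p i.succ q v * velX p i.succ q w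
          + velY p i.succ q v * velY p i.succ q w) := by
    rw [Finset.mul_sum, ← Finset.sum_add_distrib, ← Finset.sum_add_distrib]
    exact Finset.sum_congr rfl fun i _ => by rw [velX_add, velY_add]; ring
  rw [metric, lagrangian, lagrangian, lagrangian, h1, h2]
  simp only [map_add, ang_add]
  ring

lemma metric_add_left (p : Params) (q v v' w : Coord n) :
    metric p q (v + v') w = metric p q v w + metric p q v' w := by
  simp only [metric_eq, ang_add, map_add, velX_add, velY_add, add_mul, Finset.sum_add_distrib]
  ring

lemma metric_smul_left (p : Params) (q : Coord n) (c : ℝ) (v w : Coord n) :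
    metric p q (c • v) w = c * metric p q v w := by
  simp only [metric_eq, ang_smul, map_smul, velX_smul, velY_smul, smul_eq_mul, mul_assoc,
    ← mul_add, ← Finset.mul_sum]
  ring

lemma metric_comm (p : Params) (q v w : Coord n) : metric p q v w = metric p q w v := by
  rw [metric, metric, add_comm v w]
  ring

lemma metric_fieldZ1 (p : Params) (hℓ : p.ℓ ≠ 0) (q v : Coord n) :
    metric p q v (fieldZ1 p q)
      = p.M * (fderiv ℝ (comX p) q v * Real.cos (ang q 0)
        + fderiv ℝ (comY p) q v * Real.sin (ang q 0))
      + p.J * ∑ i : Fin n, ang v i.succ * turnRate p (shape q) (i.val + 1)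
      + p.m * ∑ i : Fin n, relSpeed (shape q) (i.val + 1)
        * (velX p i.succ q v * Real.cos (ang q i.succ)
          + velY p i.succ q v * Real.sin (ang q i.succ)) := by
  have h : ∀ i : Fin n, velX p i.succ q v * velX p i.succ q (fieldZ1 p q)
      + velY p i.succ q v * velY p i.succ q (fieldZ1 p q)
      = relSpeed (shape q) (i.val + 1) * (velX p i.succ q v * Real.cos (ang q i.succ)
          + velY p i.succ q v * Real.sin (ang q i.succ)) := by
    intro i
    rw [(vel_fieldZ1 p hℓ q i.succ).1, (vel_fieldZ1 p hℓ q i.succ).2, Fin.val_succ]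
    ring
  rw [metric_eq]
  simp only [h, ang_fieldZ1]
  simp [fderiv_comX, fderiv_comY]

lemma metric_fieldZ2 (p : Params) (q v q' : Coord n) :
    metric p q v (fieldZ2 q') = p.J0 * ang v 0
      + p.M * p.a * (-(fderiv ℝ (comX p) q v * Real.sin (ang q 0))
        + fderiv ℝ (comY p) q v * Real.cos (ang q 0)) := by
  rw [metric_eq]
  simp only [(vel_fieldZ2 p q q' _).1, (vel_fieldZ2 p q q' _).2]
  simp [fderiv_comX, fderiv_comY]
  ring

lemma metric_fieldZ1_fieldZ1 (p : Params) (hℓ : p.ℓ ≠ 0) (q : Coord n) :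
    metric p q (fieldZ1 p q) (fieldZ1 p q) = fnR p (shape q) := by
  have h : ∀ i : Fin n, relSpeed (shape q) (i.val + 1)
        * (velX p i.succ q (fieldZ1 p q) * Real.cos (ang q i.succ)
          + velY p i.succ q (fieldZ1 p q) * Real.sin (ang q i.succ))
      = relSpeed (shape q) (i.val + 1) ^ 2 := by
    intro i
    rw [(vel_fieldZ1 p hℓ q i.succ).1, (vel_fieldZ1 p hℓ q i.succ).2, Fin.val_succ]
    linear_combination (relSpeed (shape q) (i.val + 1) ^ 2) *
      Real.sin_sq_add_cos_sq (ang q i.succ)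
  rw [metric_fieldZ1 p hℓ, fnR_eq_sum]
  simp only [h, ang_fieldZ1, fderiv_comX, fderiv_comY, fieldZ1_fst, fieldZ1_snd_fst, Fin.val_succ,
    Fin.val_zero, turnRate_zero, ← sq]
  linear_combination p.M * Real.sin_sq_add_cos_sq (ang q 0)

lemma metric_fieldZ1_fieldZ2 (p : Params) (q q' : Coord n) :
    metric p q (fieldZ1 p q) (fieldZ2 q') = 0 := by
  rw [metric_fieldZ2]
  simp [fderiv_comX, fderiv_comY]
  ring_nf
  simp

lemma metric_fieldZ2_fieldZ2 (p : Params) (q q' : Coord n) :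
    metric p q (fieldZ2 q') (fieldZ2 q') = p.J0 + p.M * p.a ^ 2 := by
  rw [metric_fieldZ2]
  simp [fderiv_comX, fderiv_comY]
  linear_combination (p.M * p.a ^ 2) * Real.sin_sq_add_cos_sq (ang q 0)

lemma lagrangian_eq_metric (p : Params) (q v : Coord n) :
    lagrangian p q v = 1 / 2 * metric p q v v := by
  rw [metric_eq]
  simp only [lagrangian, sq]

lemma lagrangian_of_mem (p : Params) (hℓ : p.ℓ ≠ 0) (q v : Coord n)
    (hv : v ∈ constraintSpace p q) :
    lagrangian p q v =
      (1 / 2) * (fnR p (shape q) * speed q v ^ 2 + (p.J0 + p.M * p.a ^ 2) * spin v ^ 2) := by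
  set u := speed q v
  set ω := spin v
  have h : v = u • fieldZ1 p q + ω • fieldZ2 q := eq_combination p hℓ q v hv
  rw [lagrangian_eq_metric, h, metric_add_left, metric_smul_left, metric_smul_left,
    metric_comm p q (fieldZ1 p q), metric_comm p q (fieldZ2 q)]
  simp only [metric_add_left, metric_smul_left, metric_fieldZ1_fieldZ1 p hℓ,
    metric_fieldZ1_fieldZ2, metric_fieldZ2_fieldZ2, metric_comm p q (fieldZ2 q) (fieldZ1 p q)]
  ring

/-! ### The commutator of the two fields -/

lemma hasDerivAt_fnR_comp (p : Params) {α : ℝ → Fin n → ℝ} {α' : Fin n → ℝ} {t : ℝ}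
    (h : HasDerivAt α α' t) :
    HasDerivAt (fun s => fnR p (α s)) (∑ k : Fin n, α' k * partialR p (α t) k) t := by
  have hR := ((contDiff_fnR (r := 1) p).differentiable one_ne_zero (α t)).hasFDerivAt
  refine (hR.comp_hasDerivAt t h).congr_deriv ?_
  conv_lhs => rw [pi_eq_sum_univ' α']
  simp only [map_sum, map_smul, smul_eq_mul, partialR]

lemma hasDerivAt_relSpeed_comp {α : ℝ → Fin n → ℝ} {α' : Fin n → ℝ} {t : ℝ}
    (h : HasDerivAt α α' t) (k : ℕ) :
    HasDerivAt (fun s => relSpeed (α s) k) (fderiv ℝ (fun α => relSpeed α k) (α t) α') t :=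
  ((contDiff_relSpeed (r := 1) k).differentiable one_ne_zero (α t)).hasFDerivAt.comp_hasDerivAt t h

lemma hasDerivAt_turnRate_comp (p : Params) {α : ℝ → Fin n → ℝ} {α' : Fin n → ℝ} {t : ℝ}
    (h : HasDerivAt α α' t) (k : ℕ) :
    HasDerivAt (fun s => turnRate p (α s) k) (fderiv ℝ (fun α => turnRate p α k) (α t) α') t :=
  ((contDiff_turnRate (r := 1) p k).differentiable one_ne_zero (α t)).hasFDerivAt.comp_hasDerivAt
    t h

/-- The derivative of `R`, expressed by the derivatives of the relative speeds and turning rates of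
the trailers, of whose squares it is a sum. -/
lemma sum_mul_partialR (p : Params) (α α' : Fin n → ℝ) :
    ∑ k : Fin n, α' k * partialR p α k
      = 2 * (p.m * ∑ i : Fin n, relSpeed α (i.val + 1)
          * fderiv ℝ (fun α => relSpeed α (i.val + 1)) α α'
        + p.J * ∑ i : Fin n, turnRate p α (i.val + 1)
          * fderiv ℝ (fun α => turnRate p α (i.val + 1)) α α') := by
  have hα : HasDerivAt (fun s : ℝ => α + s • α') α' 0 := by
    simpa using ((hasDerivAt_id (0 : ℝ)).smul_const α').const_add α
  have h1 := hasDerivAt_fnR_comp p hα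
  have h2 : HasDerivAt (fun s : ℝ => ∑ i : Fin n, relSpeed (α + s • α') (i.val + 1) ^ 2) _ 0 :=
    HasDerivAt.fun_sum fun i (_ : i ∈ Finset.univ) =>
      (hasDerivAt_relSpeed_comp hα (i.val + 1)).fun_pow 2
  have h3 : HasDerivAt (fun s : ℝ => ∑ i : Fin n, turnRate p (α + s • α') (i.val + 1) ^ 2) _ 0 :=
    HasDerivAt.fun_sum fun i (_ : i ∈ Finset.univ) =>
      (hasDerivAt_turnRate_comp p hα (i.val + 1)).fun_pow 2
  have h4 := ((h2.const_mul p.m).const_add p.M).add (h3.const_mul p.J)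
  simp only [fnR_eq_sum] at h1
  have h5 := h1.unique h4
  simp only [zero_smul, add_zero] at h5
  rw [h5]
  simp only [Nat.cast_ofNat, Nat.add_one_sub_one, pow_one, mul_assoc, ← Finset.mul_sum]
  ring

/-- The `Z_2`-derivative of `Z_1` has the inner products `-Q/ℓ²` with `Z_1` and `Ma` with `Z_2`.
Along `Z_2` only `θ_0` varies, and the velocities of the trailers, as linear functions of the
generalized velocity, do not depend on it. So the trailers contribute half of the derivative of `R`
in the direction of `α_1` to the first product, and nothing to the second. -/
lemma metric_fderiv_fieldZ1 (p : Params) (hℓ : p.ℓ ≠ 0) (q : Coord n) :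
    metric p q (fderiv ℝ (fieldZ1 p) q (fieldZ2 q)) (fieldZ1 p q)
        = -(fnQ p (shape q) / p.ℓ ^ 2) ∧
    metric p q (fderiv ℝ (fieldZ1 p) q (fieldZ2 q)) (fieldZ2 q) = p.M * p.a := by
  set D := fderiv ℝ (fieldZ1 p) q (fieldZ2 q) with hD
  set γ : ℝ → Coord n := fun s => q + s • fieldZ2 q with hγ
  have hγ0 : γ 0 = q := by simp [hγ]
  have hZ : HasDerivAt (fun s => fieldZ1 p (γ s)) D 0 :=
    ((contDiff_fieldZ1 (r := 1) p).differentiable one_ne_zero q).hasFDerivAt.hasLineDerivAt _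
  have hlin (f : Coord n →L[ℝ] ℝ) : HasDerivAt (fun s => f (fieldZ1 p (γ s))) (f D) 0 :=
    f.hasFDerivAt.comp_hasDerivAt 0 hZ
  have hθ0 : HasDerivAt (fun s => ang (γ s) 0) 1 0 := by
    simpa [hγ] using (hasDerivAt_id (0 : ℝ)).const_add (ang q 0)
  have hθ (s : ℝ) (i : Fin n) : ang (γ s) i.succ = ang q i.succ := by simp [hγ]
  have hshape : HasDerivAt (fun s => shape (γ s)) (shape (fieldZ2 q)) 0 := by
    have h : (fun s => shape (γ s)) = fun s => shape q + s • shape (fieldZ2 q) := by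
      funext s
      rw [hγ, shape_add, shape_smul]
    rw [h]
    simpa using ((hasDerivAt_id (0 : ℝ)).smul_const (shape (fieldZ2 q))).const_add (shape q)
  have hx : D.1 = -Real.sin (ang q 0) := by
    have h := (hlin xCLM).unique hθ0.cos
    simpa [hγ0] using h
  have hy : D.2.1 = Real.cos (ang q 0) := by
    have h := (hlin yCLM).unique hθ0.sin
    simpa [hγ0] using h
  have ha0 : ang D 0 = 0 := (hlin (angCLM 0)).unique (hasDerivAt_const _ _)
  have ha (i : Fin n) : ang D i.succ
      = fderiv ℝ (fun α => turnRate p α (i.val + 1)) (shape q) (shape (fieldZ2 q)) := by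
    have h1 := hlin (angCLM i.succ)
    simp only [angCLM_apply, ang_fieldZ1, Fin.val_succ] at h1
    have h2 := h1.unique (hasDerivAt_turnRate_comp p hshape (i.val + 1))
    rwa [hγ0] at h2
  have hvx (i : Fin n) : velX p i.succ q D
      = fderiv ℝ (fun α => relSpeed α (i.val + 1)) (shape q) (shape (fieldZ2 q))
        * Real.cos (ang q i.succ) := by
    have h1 := hlin (fderiv ℝ (bodyX p i.succ) q)
    have h2 : (fun s => fderiv ℝ (bodyX p i.succ) q (fieldZ1 p (γ s)))
        = fun s => relSpeed (shape (γ s)) (i.val + 1) * Real.cos (ang q i.succ) := by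
      funext s
      have h3 := (vel_congr p (q := q) (q' := γ s) (fun j => by rw [hθ]) (fun j => by rw [hθ])
        i.succ (fieldZ1 p (γ s))).1
      rw [(vel_fieldZ1 p hℓ (γ s) i.succ).1, hθ] at h3
      exact h3
    rw [h2] at h1
    have h3 := h1.unique ((hasDerivAt_relSpeed_comp hshape (i.val + 1)).mul_const _)
    rwa [hγ0] at h3
  have hvy (i : Fin n) : velY p i.succ q D
      = fderiv ℝ (fun α => relSpeed α (i.val + 1)) (shape q) (shape (fieldZ2 q))
        * Real.sin (ang q i.succ) := by
    have h1 := hlin (fderiv ℝ (bodyY p i.succ) q)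
    have h2 : (fun s => fderiv ℝ (bodyY p i.succ) q (fieldZ1 p (γ s)))
        = fun s => relSpeed (shape (γ s)) (i.val + 1) * Real.sin (ang q i.succ) := by
      funext s
      have h3 := (vel_congr p (q := q) (q' := γ s) (fun j => by rw [hθ]) (fun j => by rw [hθ])
        i.succ (fieldZ1 p (γ s))).2
      rw [(vel_fieldZ1 p hℓ (γ s) i.succ).2, hθ] at h3
      exact h3
    rw [h2] at h1
    have h3 := h1.unique ((hasDerivAt_relSpeed_comp hshape (i.val + 1)).mul_const _)
    rwa [hγ0] at h3
  constructor
  · have hsum := sum_mul_partialR p (shape q) (shape (fieldZ2 q))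
    have hQ : ∑ k, shape (fieldZ2 q) k * partialR p (shape q) k
        = -2 * fnQ p (shape q) / p.ℓ ^ 2 := by
      simpa only [shape_fieldZ2] using sum_partialR_first p hℓ (shape q)
    rw [metric_fieldZ1 p hℓ, fderiv_comX, fderiv_comY, hx, hy, ha0]
    have hterm : ∀ i : Fin n, relSpeed (shape q) (i.val + 1)
          * (velX p i.succ q D * Real.cos (ang q i.succ)
            + velY p i.succ q D * Real.sin (ang q i.succ))
        = relSpeed (shape q) (i.val + 1)
          * fderiv ℝ (fun α => relSpeed α (i.val + 1)) (shape q) (shape (fieldZ2 q)) := by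
      intro i
      rw [hvx, hvy]
      linear_combination (relSpeed (shape q) (i.val + 1)
        * fderiv ℝ (fun α => relSpeed α (i.val + 1)) (shape q) (shape (fieldZ2 q)))
        * Real.sin_sq_add_cos_sq (ang q i.succ)
    simp only [hterm, ha, mul_comm (fderiv ℝ _ (shape q) (shape (fieldZ2 q))) (turnRate p _ _)]
    linear_combination (1 / 2) * hQ - (1 / 2) * hsum
  · rw [metric_fieldZ2, fderiv_comX, fderiv_comY, hx, hy, ha0]
    linear_combination (p.M * p.a) * Real.sin_sq_add_cos_sq (ang q 0)

lemma lieBracket_fields (p : Params) (q : Coord n) :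
    VectorField.lieBracket ℝ (fieldZ1 p) fieldZ2 q
      = (-1 : ℝ) • fderiv ℝ (fieldZ1 p) q (fieldZ2 q) := by
  have h : (fieldZ2 : Coord n → Coord n) = fun _ => fieldZ2 0 := rfl
  have h' : fderiv ℝ (fieldZ2 : Coord n → Coord n) q = 0 := by
    rw [h]
    exact fderiv_const_apply _
  rw [VectorField.lieBracket, h']
  simp

lemma isOrthProj_lieBracket_iff (p : Params) (hℓ : p.ℓ ≠ 0) (hR : ∀ α : Fin n → ℝ, fnR p α ≠ 0)
    (hJ : p.J0 + p.M * p.a ^ 2 ≠ 0) (q w : Coord n) :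
    IsOrthProj p q (VectorField.lieBracket ℝ (fieldZ1 p) fieldZ2 q) w ↔
      w = (fnQ p (shape q) / (p.ℓ ^ 2 * fnR p (shape q))) • fieldZ1 p q
        + (-(p.M * p.a / (p.J0 + p.M * p.a ^ 2))) • fieldZ2 q := by
  have hR' := hR (shape q)
  obtain ⟨hb1, hb2⟩ := metric_fderiv_fieldZ1 p hℓ q
  have h21 : metric p q (fieldZ2 q) (fieldZ1 p q) = 0 := by
    rw [metric_comm, metric_fieldZ1_fieldZ2]
  rw [lieBracket_fields]
  set D := fderiv ℝ (fieldZ1 p) q (fieldZ2 q)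
  have hsub (u ω : ℝ) : (-1 : ℝ) • D - (u • fieldZ1 p q + ω • fieldZ2 q)
      = (-1 : ℝ) • D + ((-u) • fieldZ1 p q + (-ω) • fieldZ2 q) := by module
  have e1 (u ω : ℝ) : metric p q ((-1 : ℝ) • D - (u • fieldZ1 p q + ω • fieldZ2 q)) (fieldZ1 p q)
      = fnQ p (shape q) / p.ℓ ^ 2 - u * fnR p (shape q) := by
    rw [hsub]
    simp only [metric_add_left, metric_smul_left, hb1, metric_fieldZ1_fieldZ1 p hℓ, h21]
    ring
  have e2 (u ω : ℝ) : metric p q ((-1 : ℝ) • D - (u • fieldZ1 p q + ω • fieldZ2 q)) (fieldZ2 q)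
      = -(p.M * p.a) - ω * (p.J0 + p.M * p.a ^ 2) := by
    rw [hsub]
    simp only [metric_add_left, metric_smul_left, hb2, metric_fieldZ1_fieldZ2,
      metric_fieldZ2_fieldZ2]
    ring
  constructor
  · rintro ⟨hw, h⟩
    have hw' := eq_combination p hℓ q w hw
    have h1 := h _ (fieldZ1_mem p hℓ q)
    have h2 := h _ (fieldZ2_mem p q q)
    rw [hw', e1] at h1
    rw [hw', e2] at h2
    rw [hw']
    congr 2
    · field_simp at h1 ⊢
      linear_combination -h1
    · field_simp
      linear_combination -h2
  · rintro rfl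
    refine ⟨combination_mem p hℓ q _ _, fun d hd => ?_⟩
    rw [eq_combination p hℓ q d hd, metric_comm, metric_add_left, metric_smul_left,
      metric_smul_left, metric_comm p q (fieldZ1 p q), metric_comm p q (fieldZ2 q), e1, e2]
    field_simp
    ring

/-! ### The Euler-Lagrange covector -/

/-- For a kinetic energy `½ ∑ w_a (dφ_a/dt)²`, the Euler-Lagrange covector is Newton's
`∑ w_a (d²φ_a/dt²) dφ_a`. This rests on the symmetry of the second derivatives of the `φ_a`. -/
lemma eulerLagrange_eq_sum {ι : Type*} [Fintype ι] (p : Params) (w : ι → ℝ) (φ : ι → Coord n → ℝ)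
    (hφ : ∀ a, ContDiff ℝ 2 (φ a))
    (hL : ∀ z v, lagrangian p z v = 1 / 2 * ∑ a, w a * fderiv ℝ (φ a) z v ^ 2)
    {q : ℝ → Coord n} {t : ℝ} (hq : DifferentiableAt ℝ q t)
    (hq' : DifferentiableAt ℝ (deriv q) t) (δ : Coord n) :
    eulerLagrange p q t δ
      = ∑ a, w a * (deriv (fun s => fderiv ℝ (φ a) (q s) (deriv q s)) t
        * fderiv ℝ (φ a) (q t) δ) := by
  have hd (a : ι) (z : Coord n) :
      HasFDerivAt (fderiv ℝ (φ a)) (fderiv ℝ (fderiv ℝ (φ a)) z) z :=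
    (((hφ a).fderiv_right (m := 1) (by norm_num)).differentiable one_ne_zero z).hasFDerivAt
  have hsymm (a : ι) (z v v' : Coord n) :
      fderiv ℝ (fderiv ℝ (φ a)) z v v' = fderiv ℝ (fderiv ℝ (φ a)) z v' v :=
    ((hφ a).contDiffAt.isSymmSndFDerivAt (by simp)) v v'
  have hp (s : ℝ) : fderiv ℝ (fun v => lagrangian p (q s) v) (deriv q s) δ
      = ∑ a, w a * (fderiv ℝ (φ a) (q s) (deriv q s) * fderiv ℝ (φ a) (q s) δ) := by
    have h1 (a : ι) : HasFDerivAt (fun v => w a * fderiv ℝ (φ a) (q s) v ^ 2) _ (deriv q s) :=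
      ((fderiv ℝ (φ a) (q s)).hasFDerivAt.pow 2).const_mul (w a)
    have h2 := (HasFDerivAt.fun_sum fun a (_ : a ∈ Finset.univ) => h1 a).const_mul (1 / 2 : ℝ)
    simp only [hL]
    rw [h2.fderiv]
    simp only [smul_apply, sum_apply, smul_eq_mul,
      Finset.mul_sum]
    refine Finset.sum_congr rfl fun a _ => ?_
    simp
    ring
  have hz : fderiv ℝ (fun z => lagrangian p z (deriv q t)) (q t) δ
      = ∑ a, w a * (fderiv ℝ (φ a) (q t) (deriv q t)
        * fderiv ℝ (fderiv ℝ (φ a)) (q t) δ (deriv q t)) := by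
    have h1 (a : ι) : HasFDerivAt (fun z => w a * fderiv ℝ (φ a) z (deriv q t) ^ 2) _ (q t) :=
      (((hd a (q t)).clm_apply (hasFDerivAt_const (deriv q t) (q t))).pow 2).const_mul (w a)
    have h2 := (HasFDerivAt.fun_sum fun a (_ : a ∈ Finset.univ) => h1 a).const_mul (1 / 2 : ℝ)
    simp only [hL]
    rw [h2.fderiv]
    simp only [smul_apply, sum_apply, smul_eq_mul,
      Finset.mul_sum]
    refine Finset.sum_congr rfl fun a _ => ?_
    simp
    ring
  have ht : HasDerivAt (fun s => ∑ a, w a *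
        (fderiv ℝ (φ a) (q s) (deriv q s) * fderiv ℝ (φ a) (q s) δ))
      (∑ a, w a * (deriv (fun s => fderiv ℝ (φ a) (q s) (deriv q s)) t * fderiv ℝ (φ a) (q t) δ
        + fderiv ℝ (φ a) (q t) (deriv q t)
          * fderiv ℝ (fderiv ℝ (φ a)) (q t) (deriv q t) δ)) t := by
    refine HasDerivAt.fun_sum fun a _ => HasDerivAt.const_mul _ ?_
    have h1 : HasDerivAt (fun s => fderiv ℝ (φ a) (q s))
        (fderiv ℝ (fderiv ℝ (φ a)) (q t) (deriv q t)) t :=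
      (hd a (q t)).comp_hasDerivAt t hq.hasDerivAt
    have h2 := (h1.clm_apply hq'.hasDerivAt).differentiableAt.hasDerivAt
    have h3 := h1.clm_apply (hasDerivAt_const t δ)
    simpa using h2.fun_mul h3
  rw [eulerLagrange, funext hp, ht.deriv, hz, ← Finset.sum_sub_distrib]
  refine Finset.sum_congr rfl fun a _ => ?_
  rw [hsymm a (q t) δ]
  ring

/-- The Euler-Lagrange covector of the vehicle: the work of the inertial forces of all bodies. -/
lemma eulerLagrange_eq (p : Params) {q : ℝ → Coord n} {t : ℝ} (hq : DifferentiableAt ℝ q t)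
    (hq' : DifferentiableAt ℝ (deriv q) t) (δ : Coord n) :
    eulerLagrange p q t δ
      = p.J0 * (deriv (fun s => ang (deriv q s) 0) t * ang δ 0)
        + p.M * (deriv (fun s => fderiv ℝ (comX p) (q s) (deriv q s)) t * fderiv ℝ (comX p) (q t) δ
          + deriv (fun s => fderiv ℝ (comY p) (q s) (deriv q s)) t * fderiv ℝ (comY p) (q t) δ)
        + p.J * ∑ i : Fin n, deriv (fun s => ang (deriv q s) i.succ) t * ang δ i.succ
        + p.m * ∑ i : Fin n,
          (deriv (fun s => velX p i.succ (q s) (deriv q s)) t * velX p i.succ (q t) δ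
            + deriv (fun s => velY p i.succ (q s) (deriv q s)) t * velY p i.succ (q t) δ) := by
  have hang (i : Fin (n + 1)) (z : Coord n) :
      fderiv ℝ (fun q : Coord n => ang q i) z = angCLM i := (hasFDerivAt_ang i z).fderiv
  -- in each of the three groups of coordinates, the entry `0` is the one of the leading car
  let w : Fin (n + 1) ⊕ Fin (n + 1) ⊕ Fin (n + 1) → ℝ :=
    Sum.elim (Fin.cons p.J0 fun _ => p.J)
      (Sum.elim (Fin.cons p.M fun _ => p.m) (Fin.cons p.M fun _ => p.m))
  let φ : Fin (n + 1) ⊕ Fin (n + 1) ⊕ Fin (n + 1) → Coord n → ℝ :=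
    Sum.elim (fun i q => ang q i)
      (Sum.elim (Fin.cons (comX p) fun i => bodyX p i.succ)
        (Fin.cons (comY p) fun i => bodyY p i.succ))
  have hφ : ∀ a, ContDiff ℝ 2 (φ a) := by
    rintro (i | i | i)
    · exact contDiff_ang i
    · cases i using Fin.cases with
      | zero => exact contDiff_comX p
      | succ i => exact contDiff_bodyX p i.succ
    · cases i using Fin.cases with
      | zero => exact contDiff_comY p
      | succ i => exact contDiff_bodyY p i.succ
  have hL : ∀ z v, lagrangian p z v = 1 / 2 * ∑ a, w a * fderiv ℝ (φ a) z v ^ 2 := by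
    intro z v
    simp only [w, φ, Fintype.sum_sum_type, Fin.sum_univ_succ, Sum.elim_inl, Sum.elim_inr,
      Fin.cons_zero, Fin.cons_succ, hang, angCLM_apply, lagrangian, ← Finset.mul_sum,
      Finset.sum_add_distrib, velX, velY]
    ring
  rw [eulerLagrange_eq_sum p w φ hφ hL hq hq' δ]
  simp only [w, φ, Fintype.sum_sum_type, Fin.sum_univ_succ, Sum.elim_inl, Sum.elim_inr,
    Fin.cons_zero, Fin.cons_succ, hang, angCLM_apply, ← Finset.mul_sum,
    Finset.sum_add_distrib, velX, velY]
  ring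

/-! ### The equations of motion along constrained curves -/

lemma vel_of_mem (p : Params) (hℓ : p.ℓ ≠ 0) {q v : Coord n} (hv : v ∈ constraintSpace p q)
    (i : Fin (n + 1)) :
    velX p i q v = speed q v * relSpeed (shape q) i.val * Real.cos (ang q i) ∧
    velY p i q v = speed q v * relSpeed (shape q) i.val * Real.sin (ang q i) := by
  have h := eq_combination p hℓ q v hv
  constructor
  · conv_lhs => rw [h]
    rw [velX_add, velX_smul, velX_smul, (vel_fieldZ1 p hℓ q i).1, (vel_fieldZ2 p q q i).1]
    ring
  · conv_lhs => rw [h]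
    rw [velY_add, velY_smul, velY_smul, (vel_fieldZ1 p hℓ q i).2, (vel_fieldZ2 p q q i).2]
    ring

lemma ang_succ_of_mem (p : Params) (hℓ : p.ℓ ≠ 0) {q v : Coord n} (hv : v ∈ constraintSpace p q)
    (i : Fin n) : ang v i.succ = speed q v * turnRate p (shape q) (i.val + 1) := by
  conv_lhs => rw [eq_combination p hℓ q v hv]
  simp [ang_fieldZ1]

lemma shape_of_mem (p : Params) (hℓ : p.ℓ ≠ 0) {q v : Coord n} (hv : v ∈ constraintSpace p q)
    (k : Fin n) : shape v k = speed q v * coeffA p (shape q) (k.val + 1)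
      + spin v * (if k.val = 0 then 1 else 0) := by
  conv_lhs => rw [eq_combination p hℓ q v hv]
  rw [shape_add, shape_smul, shape_smul, shape_fieldZ1, shape_fieldZ2]
  rfl

lemma com_of_mem (p : Params) (hℓ : p.ℓ ≠ 0) {q v : Coord n} (hv : v ∈ constraintSpace p q) :
    fderiv ℝ (comX p) q v = speed q v * Real.cos (ang q 0) - p.a * Real.sin (ang q 0) * spin v ∧
    fderiv ℝ (comY p) q v = speed q v * Real.sin (ang q 0) + p.a * Real.cos (ang q 0) * spin v := by
  have h := vel_of_mem p hℓ hv 0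
  simp only [velX_zero, velY_zero, Fin.val_zero, relSpeed_zero, mul_one] at h
  rw [fderiv_comX, fderiv_comY, ← h.1, ← h.2]
  exact ⟨rfl, rfl⟩

lemma hasDerivAt_ang {q : ℝ → Coord n} {t : ℝ} {v : Coord n} (h : HasDerivAt q v t)
    (i : Fin (n + 1)) : HasDerivAt (fun s => ang (q s) i) (ang v i) t :=
  (angCLM i).hasFDerivAt.comp_hasDerivAt t h

lemma hasDerivAt_shape {q : ℝ → Coord n} {t : ℝ} {v : Coord n} (h : HasDerivAt q v t) :
    HasDerivAt (fun s => shape (q s)) (shape v) t :=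
  hasDerivAt_pi.mpr fun _ => (hasDerivAt_ang h _).sub (hasDerivAt_ang h _)

lemma differentiableAt_speed {q : ℝ → Coord n} {t : ℝ} (hq : DifferentiableAt ℝ q t)
    (hq' : DifferentiableAt ℝ (deriv q) t) :
    DifferentiableAt ℝ (fun s => speed (q s) (deriv q s)) t := by
  have h0 := hasDerivAt_ang hq.hasDerivAt 0
  have hx : HasDerivAt (fun s => (deriv q s).1) _ t :=
    xCLM.hasFDerivAt.comp_hasDerivAt t hq'.hasDerivAt
  have hy : HasDerivAt (fun s => (deriv q s).2.1) _ t :=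
    yCLM.hasFDerivAt.comp_hasDerivAt t hq'.hasDerivAt
  exact ((hx.mul h0.cos).add (hy.mul h0.sin)).differentiableAt

lemma differentiableAt_spin {q : ℝ → Coord n} {t : ℝ} (hq' : DifferentiableAt ℝ (deriv q) t) :
    DifferentiableAt ℝ (fun s => spin (deriv q s)) t :=
  (hasDerivAt_ang hq'.hasDerivAt 0).differentiableAt

/-- The acceleration of the centre of mass of the leading car along a constrained curve. -/
lemma deriv_com (p : Params) (hℓ : p.ℓ ≠ 0) {q : ℝ → Coord n} {t : ℝ}
    (hq : DifferentiableAt ℝ q t) (hq' : DifferentiableAt ℝ (deriv q) t)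
    (hD : ∀ᶠ s in nhds t, deriv q s ∈ constraintSpace p (q s)) :
    deriv (fun s => fderiv ℝ (comX p) (q s) (deriv q s)) t
      = (deriv (fun s => speed (q s) (deriv q s)) t - p.a * spin (deriv q t) ^ 2)
          * Real.cos (ang (q t) 0)
        - (speed (q t) (deriv q t) * spin (deriv q t)
          + p.a * deriv (fun s => spin (deriv q s)) t) * Real.sin (ang (q t) 0) ∧
    deriv (fun s => fderiv ℝ (comY p) (q s) (deriv q s)) t
      = (deriv (fun s => speed (q s) (deriv q s)) t - p.a * spin (deriv q t) ^ 2)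
          * Real.sin (ang (q t) 0)
        + (speed (q t) (deriv q t) * spin (deriv q t)
          + p.a * deriv (fun s => spin (deriv q s)) t) * Real.cos (ang (q t) 0) := by
  have hU := (differentiableAt_speed hq hq').hasDerivAt
  have hW := (differentiableAt_spin hq').hasDerivAt
  have h0 := hasDerivAt_ang hq.hasDerivAt 0
  change HasDerivAt _ (spin (deriv q t)) t at h0
  constructor
  · refine HasDerivAt.deriv ?_
    have h := (hU.mul h0.cos).sub ((h0.sin.const_mul p.a).mul hW)
    refine (h.congr_of_eventuallyEq ?_).congr_deriv ?_
    · filter_upwards [hD] with s hs using (com_of_mem p hℓ hs).1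
    · ring
  · refine HasDerivAt.deriv ?_
    have h := (hU.mul h0.sin).add ((h0.cos.const_mul p.a).mul hW)
    refine (h.congr_of_eventuallyEq ?_).congr_deriv ?_
    · filter_upwards [hD] with s hs using (com_of_mem p hℓ hs).2
    · ring

/-- The component of the acceleration of a trailer along its axis, on a constrained curve. -/
lemma deriv_vel (p : Params) (hℓ : p.ℓ ≠ 0) {q : ℝ → Coord n} {t : ℝ}
    (hq : DifferentiableAt ℝ q t) (hq' : DifferentiableAt ℝ (deriv q) t)
    (hD : ∀ᶠ s in nhds t, deriv q s ∈ constraintSpace p (q s)) (i : Fin n) :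
    deriv (fun s => velX p i.succ (q s) (deriv q s)) t * Real.cos (ang (q t) i.succ)
      + deriv (fun s => velY p i.succ (q s) (deriv q s)) t * Real.sin (ang (q t) i.succ)
    = deriv (fun s => speed (q s) (deriv q s)) t * relSpeed (shape (q t)) (i.val + 1)
      + speed (q t) (deriv q t)
        * fderiv ℝ (fun α => relSpeed α (i.val + 1)) (shape (q t)) (shape (deriv q t)) := by
  have hU := (differentiableAt_speed hq hq').hasDerivAt
  have hc := hU.mul (hasDerivAt_relSpeed_comp (hasDerivAt_shape hq.hasDerivAt) (i.val + 1))
  have hi := hasDerivAt_ang hq.hasDerivAt i.succ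
  have hx := (hc.mul hi.cos).congr_of_eventuallyEq
    (f₁ := fun s => velX p i.succ (q s) (deriv q s))
    (by filter_upwards [hD] with s hs using (vel_of_mem p hℓ hs i.succ).1)
  have hy := (hc.mul hi.sin).congr_of_eventuallyEq
    (f₁ := fun s => velY p i.succ (q s) (deriv q s))
    (by filter_upwards [hD] with s hs using (vel_of_mem p hℓ hs i.succ).2)
  rw [hx.deriv, hy.deriv]
  simp only [Pi.mul_apply]
  linear_combination (deriv (fun s => speed (q s) (deriv q s)) t
      * relSpeed (shape (q t)) (i.val + 1)
    + speed (q t) (deriv q t)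
      * fderiv ℝ (fun α => relSpeed α (i.val + 1)) (shape (q t)) (shape (deriv q t)))
    * Real.sin_sq_add_cos_sq (ang (q t) i.succ)

lemma deriv_ang_succ (p : Params) (hℓ : p.ℓ ≠ 0) {q : ℝ → Coord n} {t : ℝ}
    (hq : DifferentiableAt ℝ q t) (hq' : DifferentiableAt ℝ (deriv q) t)
    (hD : ∀ᶠ s in nhds t, deriv q s ∈ constraintSpace p (q s)) (i : Fin n) :
    deriv (fun s => ang (deriv q s) i.succ) t
    = deriv (fun s => speed (q s) (deriv q s)) t * turnRate p (shape (q t)) (i.val + 1)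
      + speed (q t) (deriv q t)
        * fderiv ℝ (fun α => turnRate p α (i.val + 1)) (shape (q t)) (shape (deriv q t)) := by
  have hU := (differentiableAt_speed hq hq').hasDerivAt
  have hc := hU.mul (hasDerivAt_turnRate_comp p (hasDerivAt_shape hq.hasDerivAt) (i.val + 1))
  exact (hc.congr_of_eventuallyEq
    (by filter_upwards [hD] with s hs using ang_succ_of_mem p hℓ hs i)).deriv

/-- The component of the equations of motion along `Z_1`. -/
lemma eulerLagrange_fieldZ1 (p : Params) (hℓ : p.ℓ ≠ 0) {q : ℝ → Coord n} {t : ℝ}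
    (hq : DifferentiableAt ℝ q t) (hq' : DifferentiableAt ℝ (deriv q) t)
    (hD : ∀ᶠ s in nhds t, deriv q s ∈ constraintSpace p (q s)) :
    eulerLagrange p q t (fieldZ1 p (q t))
      = fnR p (shape (q t)) * deriv (fun s => speed (q s) (deriv q s)) t
        + 1 / 2 * (∑ k : Fin n, coeffA p (shape (q t)) (k.val + 1) * partialR p (shape (q t)) k)
          * speed (q t) (deriv q t) ^ 2
        - fnQ p (shape (q t)) / p.ℓ ^ 2 * (speed (q t) (deriv q t) * spin (deriv q t))
        - p.M * p.a * spin (deriv q t) ^ 2 := by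
  obtain ⟨hcx, hcy⟩ := deriv_com p hℓ hq hq' hD
  have hvel := deriv_vel p hℓ hq hq' hD
  have hang := deriv_ang_succ p hℓ hq hq' hD
  have hR := sum_mul_partialR p (shape (q t)) (shape (deriv q t))
  have hsh := shape_of_mem p hℓ hD.self_of_nhds
  have hQ := sum_partialR_first p hℓ (shape (q t))
  set u := speed (q t) (deriv q t)
  set ω := spin (deriv q t)
  set u' := deriv (fun s => speed (q s) (deriv q s)) t
  set α := shape (q t)
  simp only [hsh, add_mul, Finset.sum_add_distrib, mul_assoc, ← Finset.mul_sum] at hR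
  have hx : ∀ i : Fin n,
      deriv (fun s => velX p i.succ (q s) (deriv q s)) t * velX p i.succ (q t) (fieldZ1 p (q t))
        + deriv (fun s => velY p i.succ (q s) (deriv q s)) t
          * velY p i.succ (q t) (fieldZ1 p (q t))
      = u' * relSpeed α (i.val + 1) ^ 2 + u * (relSpeed α (i.val + 1)
        * fderiv ℝ (fun α => relSpeed α (i.val + 1)) α (shape (deriv q t))) := by
    intro i
    rw [(vel_fieldZ1 p hℓ (q t) i.succ).1, (vel_fieldZ1 p hℓ (q t) i.succ).2, Fin.val_succ]
    linear_combination relSpeed α (i.val + 1) * hvel i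
  have ha : ∀ i : Fin n,
      deriv (fun s => ang (deriv q s) i.succ) t * ang (fieldZ1 p (q t)) i.succ
      = u' * turnRate p α (i.val + 1) ^ 2 + u * (turnRate p α (i.val + 1)
        * fderiv ℝ (fun α => turnRate p α (i.val + 1)) α (shape (deriv q t))) := by
    intro i
    rw [hang, ang_fieldZ1, Fin.val_succ]
    ring
  rw [eulerLagrange_eq p hq hq', hcx, hcy]
  simp only [hx, ha, fderiv_comX, fderiv_comY, ang_fieldZ1_zero, fieldZ1_fst,
    fieldZ1_snd_fst, Finset.sum_add_distrib, ← Finset.mul_sum]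
  rw [fnR_eq_sum]
  linear_combination (p.M * (u' - p.a * ω ^ 2)) * Real.sin_sq_add_cos_sq (ang (q t) 0)
    - (1 / 2 * u) * hR + (1 / 2 * u * ω) * hQ

/-- The component of the equations of motion along `Z_2`. -/
lemma eulerLagrange_fieldZ2 (p : Params) (hℓ : p.ℓ ≠ 0) {q : ℝ → Coord n} {t : ℝ}
    (hq : DifferentiableAt ℝ q t) (hq' : DifferentiableAt ℝ (deriv q) t)
    (hD : ∀ᶠ s in nhds t, deriv q s ∈ constraintSpace p (q s)) :
    eulerLagrange p q t (fieldZ2 (q t))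
      = (p.J0 + p.M * p.a ^ 2) * deriv (fun s => spin (deriv q s)) t
        + p.M * p.a * (speed (q t) (deriv q t) * spin (deriv q t)) := by
  obtain ⟨hcx, hcy⟩ := deriv_com p hℓ hq hq' hD
  have h0 : deriv (fun s => ang (deriv q s) 0) t = deriv (fun s => spin (deriv q s)) t := rfl
  rw [eulerLagrange_eq p hq hq', h0, hcx, hcy]
  simp only [(vel_fieldZ2 p (q t) (q t) _).1, (vel_fieldZ2 p (q t) (q t) _).2, fderiv_comX,
    fderiv_comY, ang_fieldZ2_zero, ang_fieldZ2_succ, fieldZ2_fst, fieldZ2_snd_fst, mul_zero,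
    add_zero, Finset.sum_const_zero, mul_one]
  linear_combination (p.M * p.a * (speed (q t) (deriv q t) * spin (deriv q t)
    + p.a * deriv (fun s => spin (deriv q s)) t)) * Real.sin_sq_add_cos_sq (ang (q t) 0)

lemma eulerLagrange_combination (p : Params) {q : ℝ → Coord n} {t : ℝ}
    (hq : DifferentiableAt ℝ q t) (hq' : DifferentiableAt ℝ (deriv q) t) (b c : ℝ)
    (v w : Coord n) :
    eulerLagrange p q t (b • v + c • w) = b * eulerLagrange p q t v + c * eulerLagrange p q t w := by
  simp only [eulerLagrange_eq p hq hq', ang_add, ang_smul, velX_add, velX_smul, velY_add,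
    velY_smul, map_add, map_smul, smul_eq_mul, Finset.mul_sum, mul_add, Finset.sum_add_distrib]
  ring_nf

/-- The Lagrange-d'Alembert principle on a constrained curve amounts to the equations for the
derivatives of `u` and `ω`. -/
lemma dAlembert_iff (p : Params) (hℓ : p.ℓ ≠ 0) {q : ℝ → Coord n} {t : ℝ}
    (hR : fnR p (shape (q t)) ≠ 0) (hJ : p.J0 + p.M * p.a ^ 2 ≠ 0)
    (hq : DifferentiableAt ℝ q t) (hq' : DifferentiableAt ℝ (deriv q) t)
    (hD : ∀ᶠ s in nhds t, deriv q s ∈ constraintSpace p (q s)) :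
    (∀ δ ∈ constraintSpace p (q t), eulerLagrange p q t δ = 0) ↔
      deriv (fun s => speed (q s) (deriv q s)) t
        = -(1 / (2 * fnR p (shape (q t))) * (∑ k : Fin n,
            coeffA p (shape (q t)) (k.val + 1) * partialR p (shape (q t)) k))
              * speed (q t) (deriv q t) ^ 2
          + fnQ p (shape (q t)) / (p.ℓ ^ 2 * fnR p (shape (q t)))
            * (speed (q t) (deriv q t) * spin (deriv q t))
          + p.M * p.a / fnR p (shape (q t)) * spin (deriv q t) ^ 2 ∧
      deriv (fun s => spin (deriv q s)) t
        = -(p.M * p.a * speed (q t) (deriv q t) * spin (deriv q t)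
            / (p.J0 + p.M * p.a ^ 2)) := by
  have h1 := eulerLagrange_fieldZ1 p hℓ hq hq' hD
  have h2 := eulerLagrange_fieldZ2 p hℓ hq hq' hD
  set u := speed (q t) (deriv q t)
  set ω := spin (deriv q t)
  set u' := deriv (fun s => speed (q s) (deriv q s)) t
  set ω' := deriv (fun s => spin (deriv q s)) t
  constructor
  · intro h
    rw [h _ (fieldZ1_mem p hℓ _)] at h1
    rw [h _ (fieldZ2_mem p _ _)] at h2
    constructor
    · field_simp at h1 ⊢
      linear_combination -h1
    · field_simp
      linear_combination -h2
  · rintro ⟨e1, e2⟩ δ hδ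
    rw [eq_combination p hℓ _ δ hδ, eulerLagrange_combination p hq hq', h1, h2, e1, e2]
    field_simp
    ring

/-! ### Reduction and reconstruction -/

/-- The equations for the shape angles in terms of the coefficients `A_k`; those for `k = 1` and
`k ≥ 2` are merged, the term `ω` being present only for the first angle. -/
lemma hasDerivAt_shape_iff (p : Params) (α : ℝ → Fin n → ℝ) (u ω t : ℝ) :
    HasDerivAt α (fun k : Fin n => u * coeffA p (α t) (k.val + 1)
        + ω * (if k.val = 0 then 1 else 0)) t ↔
      (1 ≤ n → HasDerivAt (fun s => al (α s) 1) (ω - u * Real.sin (al (α t) 1) / p.ℓ) t) ∧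
      ∀ k : ℕ, 2 ≤ k → k ≤ n → HasDerivAt (fun s => al (α s) k)
        (u / p.ℓ * (∏ j ∈ Finset.Icc 1 (k - 2), Real.cos (al (α t) j)) *
          (Real.sin (al (α t) (k - 1)) - Real.cos (al (α t) (k - 1)) * Real.sin (al (α t) k))) t := by
  rw [hasDerivAt_pi]
  have hal (k : Fin n) : (fun s => α s k) = fun s => al (α s) (k.val + 1) :=
    funext fun s => (al_succ (α s) k).symm
  have hone : u * coeffA p (α t) 1 + ω = ω - u * Real.sin (al (α t) 1) / p.ℓ := by
    simp [coeffA]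
    ring
  have htwo (k : ℕ) : u * coeffA p (α t) k
      = u / p.ℓ * (∏ j ∈ Finset.Icc 1 (k - 2), Real.cos (al (α t) j)) *
        (Real.sin (al (α t) (k - 1)) - Real.cos (al (α t) (k - 1)) * Real.sin (al (α t) k)) := by
    rw [coeffA]
    ring
  constructor
  · intro h
    constructor
    · intro hn
      have h1 := h ⟨0, hn⟩
      rw [hal] at h1
      simpa [hone] using h1
    · intro k hk hkn
      have h1 := h ⟨k - 1, by omega⟩
      rw [hal] at h1
      simp only [show k - 1 + 1 = k by omega, if_neg (show ¬ k - 1 = 0 by omega), mul_zero,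
        add_zero] at h1
      rwa [htwo] at h1
  · rintro ⟨h1, h2⟩ k
    rw [hal]
    by_cases hk : k.val = 0
    · have h3 := h1 (by have := k.isLt; omega)
      rw [← hone] at h3
      simpa [hk] using h3
    · have h3 := h2 (k.val + 1) (by omega) (by have := k.isLt; omega)
      rw [← htwo] at h3
      simpa [hk] using h3

lemma IsMotion.differentiableAt {p : Params} {I : Set ℝ} {q : ℝ → Coord n} (h : IsMotion p I q)
    (hI : IsOpen I) {t : ℝ} (ht : t ∈ I) :
    DifferentiableAt ℝ q t ∧ DifferentiableAt ℝ (deriv q) t := by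
  have h2 : ContDiffOn ℝ (1 + 1) q I := by
    rw [one_add_one_eq_two]
    exact h.contDiffOn
  obtain ⟨h3, -, h4⟩ := (contDiffOn_succ_iff_deriv_of_isOpen hI).mp h2
  exact ⟨h3.differentiableAt (hI.mem_nhds ht),
    (h4.differentiableOn one_ne_zero).differentiableAt (hI.mem_nhds ht)⟩

/-- Every motion projects to a solution of the reduced equations. -/
lemma IsMotion.isReducedSolution {p : Params} {I : Set ℝ} {q : ℝ → Coord n} (h : IsMotion p I q)
    (hI : IsOpen I) (hℓ : p.ℓ ≠ 0) (hR : ∀ α : Fin n → ℝ, fnR p α ≠ 0)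
    (hJ : p.J0 + p.M * p.a ^ 2 ≠ 0) :
    IsReducedSolution p I (fun t => speed (q t) (deriv q t)) (fun t => spin (deriv q t))
      (fun t => shape (q t)) := by
  have hD : ∀ t ∈ I, ∀ᶠ s in nhds t, deriv q s ∈ constraintSpace p (q s) := fun t ht => by
    filter_upwards [hI.mem_nhds ht] with s hs using h.constraint s hs
  have heq : ∀ t ∈ I, _ := fun t ht => (dAlembert_iff p hℓ (hR _) hJ (h.differentiableAt hI ht).1
    (h.differentiableAt hI ht).2 (hD t ht)).mp (h.dAlembert t ht)
  have hα : ∀ t ∈ I, _ := fun t ht =>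
    (hasDerivAt_shape_iff p (fun t => shape (q t)) (speed (q t) (deriv q t)) (spin (deriv q t))
      t).mp ((hasDerivAt_shape (h.differentiableAt hI ht).1.hasDerivAt).congr_deriv
        (funext (shape_of_mem p hℓ (h.constraint t ht))))
  refine ⟨fun t ht => ?_, fun t ht => ?_, fun t ht => (hα t ht).1, fun t ht => (hα t ht).2⟩
  · obtain ⟨h1, h2⟩ := h.differentiableAt hI ht
    rw [← (heq t ht).1]
    exact (differentiableAt_speed h1 h2).hasDerivAt
  · obtain ⟨h1, h2⟩ := h.differentiableAt hI ht
    rw [← (heq t ht).2]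
    exact (differentiableAt_spin h2).hasDerivAt

lemma exists_primitive {I : Set ℝ} (hI : IsOpen I) (hI' : I.OrdConnected) {f : ℝ → ℝ}
    (hf : ContinuousOn f I) {t₀ : ℝ} (ht₀ : t₀ ∈ I) (c : ℝ) :
    ∃ F : ℝ → ℝ, F t₀ = c ∧ ∀ t ∈ I, HasDerivAt F (f t) t := by
  refine ⟨fun t => c + ∫ s in t₀..t, f s, by simp, fun t ht => ?_⟩
  refine HasDerivAt.const_add c (intervalIntegral.integral_hasDerivAt_right ?_ ?_ ?_)
  · exact (hf.mono (hI'.uIcc_subset ht₀ ht)).intervalIntegrable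
  · exact hf.stronglyMeasurableAtFilter hI t ht
  · exact hf.continuousAt (hI.mem_nhds ht)

lemma contDiffOn_succ_of_hasDerivAt {E : Type*} [NormedAddCommGroup E] [NormedSpace ℝ E]
    {I : Set ℝ} (hI : IsOpen I) {f f' : ℝ → E} (r : ℕ) (h : ∀ t ∈ I, HasDerivAt f (f' t) t)
    (hf' : ContDiffOn ℝ r f' I) : ContDiffOn ℝ (r + 1) f I := by
  refine (contDiffOn_succ_iff_deriv_of_isOpen hI).mpr
    ⟨fun t ht => (h t ht).differentiableAt.differentiableWithinAt, by simp, ?_⟩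
  exact hf'.congr fun t ht => (h t ht).deriv

/-- Two constrained curves with the same reduced curve and a common configuration coincide: the
heading of the leading car, and then its position, are primitives of the same functions. -/
lemma eqOn_of_reduced_eq (p : Params) (hℓ : p.ℓ ≠ 0) {I : Set ℝ} (hI : IsOpen I)
    (hI' : I.OrdConnected) {q q' : ℝ → Coord n} (hq : ∀ t ∈ I, DifferentiableAt ℝ q t)
    (hq' : ∀ t ∈ I, DifferentiableAt ℝ q' t)
    (hD : ∀ t ∈ I, deriv q t ∈ constraintSpace p (q t))
    (hD' : ∀ t ∈ I, deriv q' t ∈ constraintSpace p (q' t))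
    (hshape : ∀ t ∈ I, shape (q t) = shape (q' t))
    (hspeed : ∀ t ∈ I, speed (q t) (deriv q t) = speed (q' t) (deriv q' t))
    (hspin : ∀ t ∈ I, spin (deriv q t) = spin (deriv q' t)) {t₀ : ℝ} (ht₀ : t₀ ∈ I)
    (h0 : q t₀ = q' t₀) : Set.EqOn q q' I := by
  have key {f f' g g' : ℝ → ℝ} (hf : ∀ t ∈ I, HasDerivAt f (f' t) t)
      (hg : ∀ t ∈ I, HasDerivAt g (g' t) t) (h : ∀ t ∈ I, f' t = g' t) (h0 : f t₀ = g t₀) :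
      Set.EqOn f g I :=
    hI.eqOn_of_deriv_eq hI'.isPreconnected
      (fun t ht => (hf t ht).differentiableAt.differentiableWithinAt)
      (fun t ht => (hg t ht).differentiableAt.differentiableWithinAt)
      (fun t ht => by rw [(hf t ht).deriv, (hg t ht).deriv, h t ht]) ht₀ h0
  have hθ := key (fun t ht => hasDerivAt_ang (hq t ht).hasDerivAt 0)
    (fun t ht => hasDerivAt_ang (hq' t ht).hasDerivAt 0) hspin (by rw [h0])
  have hx := key
    (fun t ht => (xCLM (n := n)).hasFDerivAt.comp_hasDerivAt t (hq t ht).hasDerivAt)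
    (fun t ht => (xCLM (n := n)).hasFDerivAt.comp_hasDerivAt t (hq' t ht).hasDerivAt)
    (fun t ht => by
      have h1 := (vel_of_mem p hℓ (hD t ht) 0).1
      have h2 := (vel_of_mem p hℓ (hD' t ht) 0).1
      simp only [velX_zero] at h1 h2
      rw [xCLM_apply, xCLM_apply, h1, h2, hspeed t ht, hshape t ht, show ang (q t) 0 = _ from
        hθ ht])
    (by simp [h0])
  have hy := key
    (fun t ht => (yCLM (n := n)).hasFDerivAt.comp_hasDerivAt t (hq t ht).hasDerivAt)
    (fun t ht => (yCLM (n := n)).hasFDerivAt.comp_hasDerivAt t (hq' t ht).hasDerivAt)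
    (fun t ht => by
      have h1 := (vel_of_mem p hℓ (hD t ht) 0).2
      have h2 := (vel_of_mem p hℓ (hD' t ht) 0).2
      simp only [velY_zero] at h1 h2
      rw [yCLM_apply, yCLM_apply, h1, h2, hspeed t ht, hshape t ht, show ang (q t) 0 = _ from
        hθ ht])
    (by simp [h0])
  exact fun t ht => coord_ext_shape (hx ht) (hy ht) (hθ ht) (hshape t ht)

/-- Every solution of the reduced equations lifts to a motion through a given configuration. The
heading and then the position of the leading car are obtained by quadratures. -/
lemma IsReducedSolution.exists_motion {p : Params} {I : Set ℝ} {u ω : ℝ → ℝ} {α : ℝ → Fin n → ℝ}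
    (h : IsReducedSolution p I u ω α) (hI : IsOpen I) (hI' : I.OrdConnected) (hℓ : p.ℓ ≠ 0)
    (hR : ∀ α : Fin n → ℝ, fnR p α ≠ 0) (hJ : p.J0 + p.M * p.a ^ 2 ≠ 0) {t₀ : ℝ} (ht₀ : t₀ ∈ I)
    (q₀ : Coord n) (hq₀ : shape q₀ = α t₀) :
    ∃ q : ℝ → Coord n, IsMotion p I q ∧ q t₀ = q₀ ∧ ∀ t ∈ I, shape (q t) = α t ∧
      speed (q t) (deriv q t) = u t ∧ spin (deriv q t) = ω t := by
  have hu : ContinuousOn u I := fun t ht => (h.eq_u t ht).continuousAt.continuousWithinAt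
  have hω : ContinuousOn ω I := fun t ht => (h.eq_ω t ht).continuousAt.continuousWithinAt
  have hα' : ∀ t ∈ I, _ := fun t ht =>
    (hasDerivAt_shape_iff p α (u t) (ω t) t).mpr ⟨h.eq_α_one t ht, h.eq_α t ht⟩
  have hα : ContinuousOn α I := fun t ht => (hα' t ht).continuousAt.continuousWithinAt
  obtain ⟨θ, hθ0, hθ⟩ := exists_primitive hI hI' hω ht₀ (ang q₀ 0)
  have hθc : ContinuousOn θ I := fun t ht => (hθ t ht).continuousAt.continuousWithinAt
  obtain ⟨x, hx0, hx⟩ := exists_primitive hI hI'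
    (hu.mul (Real.continuous_cos.comp_continuousOn hθc)) ht₀ q₀.1
  obtain ⟨y, hy0, hy⟩ := exists_primitive hI hI'
    (hu.mul (Real.continuous_sin.comp_continuousOn hθc)) ht₀ q₀.2.1
  set q : ℝ → Coord n := fun t => ofShape (x t) (y t) (θ t) (α t) with hq
  have hshape (t : ℝ) : shape (q t) = α t := shape_ofShape _ _ _ _
  have hq' : ∀ t ∈ I, HasDerivAt q (u t • fieldZ1 p (q t) + ω t • fieldZ2 (q t)) t := by
    intro t ht
    have h1 : HasDerivAt q _ t := (ofShapeCLM (n := n)).hasFDerivAt.comp_hasDerivAt t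
      ((hx t ht).prodMk ((hy t ht).prodMk ((hθ t ht).prodMk (hα' t ht))))
    refine h1.congr_deriv ?_
    rw [ofShapeCLM_apply]
    refine coord_ext_shape ?_ ?_ ?_ ?_
    · simp [hq]
    · simp [hq]
    · simp
    · rw [shape_ofShape, shape_add, shape_smul, shape_smul, shape_fieldZ1, shape_fieldZ2, hshape]
      rfl
  have hmem : ∀ t ∈ I, deriv q t ∈ constraintSpace p (q t) := fun t ht => by
    rw [(hq' t ht).deriv]
    exact combination_mem p hℓ _ _ _
  have hspeed : ∀ t ∈ I, speed (q t) (deriv q t) = u t := fun t ht => by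
    rw [(hq' t ht).deriv, speed_combination]
  have hspin : ∀ t ∈ I, spin (deriv q t) = ω t := fun t ht => by
    rw [(hq' t ht).deriv, spin_combination]
  -- regularity: `u`, `ω` and `q` are `C¹`, hence the right hand side of the equation for `q` is
  have hu1 : ContDiffOn ℝ 1 u I := by
    refine contDiffOn_succ_of_hasDerivAt hI 0 h.eq_u (contDiffOn_zero.mpr ?_)
    have hRc : ContinuousOn (fun t => fnR p (α t)) I :=
      (contDiff_fnR (r := 0) p).continuous.comp_continuousOn hα
    have hQc : ContinuousOn (fun t => fnQ p (α t)) I :=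
      (continuous_fnQ p).comp_continuousOn hα
    have hsum : ContinuousOn (fun t => ∑ k : Fin n,
        coeffA p (α t) (k.val + 1) * partialR p (α t) k) I :=
      continuousOn_finsetSum _ fun k _ =>
        ((continuous_coeffA p k).comp_continuousOn hα).mul
          ((continuous_partialR p k).comp_continuousOn hα)
    have hR2 : ∀ t ∈ I, 2 * fnR p (α t) ≠ 0 := fun t _ => mul_ne_zero two_ne_zero (hR _)
    have hR3 : ∀ t ∈ I, p.ℓ ^ 2 * fnR p (α t) ≠ 0 := fun t _ =>
      mul_ne_zero (pow_ne_zero 2 hℓ) (hR _)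
    exact ((((continuousOn_const.div (continuousOn_const.mul hRc) hR2).mul hsum).neg.mul
      (hu.pow 2)).add ((hQc.div (continuousOn_const.mul hRc) hR3).mul (hu.mul hω))).add
      ((continuousOn_const.div hRc fun t _ => hR _).mul (hω.pow 2))
  have hω1 : ContDiffOn ℝ 1 ω I := by
    refine contDiffOn_succ_of_hasDerivAt hI 0 h.eq_ω (contDiffOn_zero.mpr ?_)
    exact (((continuousOn_const.mul hu).mul hω).div_const _).neg
  have hrhs (r : ℕ) (hr : r ≤ 1) (hqr : ContDiffOn ℝ r q I) :
      ContDiffOn ℝ r (fun t => u t • fieldZ1 p (q t) + ω t • fieldZ2 (q t)) I := by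
    have hr' : (r : WithTop ℕ∞) ≤ 1 := by exact_mod_cast hr
    exact ((hu1.of_le hr').smul ((contDiff_fieldZ1 p).comp_contDiffOn hqr)).add
      ((hω1.of_le hr').smul contDiffOn_const)
  have hqc : ContDiffOn ℝ (0 : ℕ) q I :=
    contDiffOn_zero.mpr fun t ht => (hq' t ht).continuousAt.continuousWithinAt
  have hq1 := contDiffOn_succ_of_hasDerivAt hI 0 hq' (hrhs 0 zero_le_one hqc)
  have hq2 := contDiffOn_succ_of_hasDerivAt hI 1 hq' (hrhs 1 le_rfl (by simpa using hq1))
  have hq2' : ContDiffOn ℝ (1 + 1) q I := by simpa using hq2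
  obtain ⟨-, -, hdq⟩ := (contDiffOn_succ_iff_deriv_of_isOpen hI).mp hq2'
  refine ⟨q, ⟨by rwa [one_add_one_eq_two] at hq2', hmem, fun t ht => ?_⟩, ?_,
    fun t ht => ⟨hshape t, hspeed t ht, hspin t ht⟩⟩
  · have hD : ∀ᶠ s in nhds t, deriv q s ∈ constraintSpace p (q s) := by
      filter_upwards [hI.mem_nhds ht] with s hs using hmem s hs
    have hU : (fun s => speed (q s) (deriv q s)) =ᶠ[nhds t] u := by
      filter_upwards [hI.mem_nhds ht] with s hs using hspeed s hs
    have hW : (fun s => spin (deriv q s)) =ᶠ[nhds t] ω := by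
      filter_upwards [hI.mem_nhds ht] with s hs using hspin s hs
    refine (dAlembert_iff p hℓ (hR _) hJ (hq' t ht).differentiableAt
      ((hdq.differentiableOn one_ne_zero).differentiableAt (hI.mem_nhds ht)) hD).mpr ?_
    rw [hU.deriv_eq, hW.deriv_eq, hshape, hspeed t ht, hspin t ht, (h.eq_u t ht).deriv,
      (h.eq_ω t ht).deriv]
    exact ⟨rfl, rfl⟩
  · rw [hq]
    simp only [hx0, hy0, hθ0, ← hq₀]
    exact ofShape_shape q₀

end NTrailer

end

theorem theorem1 (n : ℕ) (p : Params) (hℓ : 0 < p.ℓ) (hM : 0 < p.M) (hJ0 : 0 < p.J0)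
    (hm : 0 ≤ p.m) (hJ : 0 ≤ p.J) :
    -- the Lagrangian and the constraints are well defined on configurations (angles modulo 2π)
    (∀ q q' : Coord n, SameConfig q q' →
      (∀ v, lagrangian p q v = lagrangian p q' v) ∧ constraintSpace p q = constraintSpace p q') ∧
    -- and they are invariant under the tangent lift of the action of SE(2)
    (∀ (φ r s : ℝ) (q v : Coord n),
      lagrangian p (act φ r s q) (actTangent φ r s q v) = lagrangian p q v ∧
      (actTangent φ r s q v ∈ constraintSpace p (act φ r s q) ↔ v ∈ constraintSpace p q)) ∧
    -- Z_1, Z_2 is a basis of the constraint distribution, with fibre coordinates u and ω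
    (∀ q : Coord n, LinearIndependent ℝ ![fieldZ1 p q, fieldZ2 q] ∧
      Submodule.span ℝ {fieldZ1 p q, fieldZ2 q} = constraintSpace p q ∧
      ∀ v ∈ constraintSpace p q, v = speed q v • fieldZ1 p q + spin v • fieldZ2 q) ∧
    -- (α, u, ω) are coordinates on the quotient of the constraint distribution by SE(2)
    (∀ q q' v v' : Coord n, v ∈ constraintSpace p q → v' ∈ constraintSpace p q' →
      ((∃ φ r s : ℝ, SameConfig (act φ r s q) q' ∧ actTangent φ r s q v = v') ↔
        (∀ k, (shape q k : Real.Angle) = (shape q' k : Real.Angle)) ∧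
          speed q v = speed q' v' ∧ spin v = spin v')) ∧
    (∀ (α : Fin n → ℝ) (u ω : ℝ), ∃ q : Coord n, ∃ v ∈ constraintSpace p q,
      shape q = α ∧ speed q v = u ∧ spin v = ω) ∧
    -- the constrained Lagrangian
    (∀ q : Coord n, ∀ v ∈ constraintSpace p q,
      lagrangian p q v =
        (1 / 2) * (fnR p (shape q) * speed q v ^ 2 + (p.J0 + p.M * p.a ^ 2) * spin v ^ 2)) ∧
    -- the orthogonal projection of the commutator of Z_1 and Z_2 onto the constraint distribution
    (∀ q w : Coord n,
      IsOrthProj p q (VectorField.lieBracket ℝ (fieldZ1 p) fieldZ2 q) w ↔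
        w = (fnQ p (shape q) / (p.ℓ ^ 2 * fnR p (shape q))) • fieldZ1 p q
          + (-(p.M * p.a / (p.J0 + p.M * p.a ^ 2))) • fieldZ2 q) ∧
    -- R is positive
    (∀ α : Fin n → ℝ, 0 < fnR p α) ∧
    -- every motion of the vehicle projects to a solution of the reduced equations
    (∀ (I : Set ℝ), IsOpen I → I.OrdConnected → ∀ q : ℝ → Coord n, IsMotion p I q →
      IsReducedSolution p I (fun t => speed (q t) (deriv q t)) (fun t => spin (deriv q t))
        (fun t => shape (q t))) ∧
    -- every solution of the reduced equations is the projection of a motion of the vehicle, which is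
    -- unique once the configuration at one instant is prescribed
    (∀ (I : Set ℝ), IsOpen I → I.OrdConnected →
      ∀ (u ω : ℝ → ℝ) (α : ℝ → Fin n → ℝ), IsReducedSolution p I u ω α →
      ∀ t₀ ∈ I, ∀ q₀ : Coord n, shape q₀ = α t₀ →
        ∃ q : ℝ → Coord n,
          (IsMotion p I q ∧ q t₀ = q₀ ∧ ∀ t ∈ I, shape (q t) = α t ∧
            speed (q t) (deriv q t) = u t ∧ spin (deriv q t) = ω t) ∧
          ∀ q' : ℝ → Coord n,
            (IsMotion p I q' ∧ q' t₀ = q₀ ∧ ∀ t ∈ I, shape (q' t) = α t ∧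
              speed (q' t) (deriv q' t) = u t ∧ spin (deriv q' t) = ω t) →
            Set.EqOn q' q I) := by
  have hℓ' := hℓ.ne'
  have hR : ∀ α : Fin n → ℝ, 0 < fnR p α := fnR_pos p hM hm hJ
  have hJ' : p.J0 + p.M * p.a ^ 2 ≠ 0 := by positivity
  refine ⟨fun q q' h => ⟨lagrangian_congr p h, constraintSpace_congr p h⟩,
    fun φ r s q v => ⟨lagrangian_act p φ r s q v, actTangent_mem_iff p φ r s q v⟩,
    fun q => ⟨linearIndependent_fields p q, span_fields p hℓ' q, eq_combination p hℓ' q⟩,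
    exists_act_iff p hℓ', fun α u ω => ?_, lagrangian_of_mem p hℓ',
    isOrthProj_lieBracket_iff p hℓ' (fun α => (hR α).ne') hJ', hR,
    fun I hI _ q hq => hq.isReducedSolution hI hℓ' (fun α => (hR α).ne') hJ',
    fun I hI hI' u ω α h t₀ ht₀ q₀ hq₀ => ?_⟩
  · exact ⟨ofShape 0 0 0 α, _, combination_mem p hℓ' _ u ω, shape_ofShape _ _ _ _,
      speed_combination p _ u ω, spin_combination p _ u ω⟩
  · obtain ⟨q, hq, h0, hred⟩ :=
      h.exists_motion hI hI' hℓ' (fun α => (hR α).ne') hJ' ht₀ q₀ hq₀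
    refine ⟨q, ⟨hq, h0, hred⟩, fun q' ⟨hq', h0', hred'⟩ => ?_⟩
    refine eqOn_of_reduced_eq p hℓ' hI hI' (fun t ht => (hq'.differentiableAt hI ht).1)
      (fun t ht => (hq.differentiableAt hI ht).1) hq'.constraint hq.constraint
      (fun t ht => ?_) (fun t ht => ?_) (fun t ht => ?_) ht₀ (h0'.trans h0.symm)
    · rw [(hred t ht).1, (hred' t ht).1]
    · rw [(hred t ht).2.1, (hred' t ht).2.1]
    · rw [(hred t ht).2.2, (hred' t ht).2.2]
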